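/- Let $\mathcal N(\mathbb F_2)$ be the group of power series $t+O(t^2)\in\mathbb F_2[[t]]$ under composition. The depth of $\sigma\ne t$ is $d(\sigma)=\mathrm{ord}_t(\sigma(t)-t)-1$, and the break sequence of an element $\sigma$ of order $2^n$ is $(d(\sigma^{\circ 2^i}))_{0\le i<n}$; so an element of order $2$ has break sequence $(m)$ exactly when it has depth $m$. Let $E(\sigma)$ be the set of exponents occurring in $\sigma$. The series $\sigma$ is called sparse if $\#(E(\sigma)\cap\{0,\dots,N\})=O(\log(N)^r)$ for some real $r\ge 0$, and the infimum of such $r$ is its rank of sparseness. A $2$-automaton is a finite automaton with input digits $0,1$ and outputs in $\mathbb F_2$, with all states accessible, in which an edge labelled $0$ joins states with equal output; it produces the series whose $k$-th coefficient is the output of the state reached by reading the binary digits of $k$ from the least significant one. Proposition. Let $m=2^\mu\pm1$ with $\mu\ge1$. Then every element of order $2$ and break sequence $(m)$ in $\mathcal N(\mathbb F_2)$ is conjugate in $\mathcal N(\mathbb F_2)$ to a sparse power series. More precisely, in each of the following cases the displayed series $\sigma_{S,m}$ belongs to $\mathcal N(\mathbb F_2)$, has order $2$ and break sequence $(m)$,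 every element of order $2$ and break sequence $(m)$ is conjugate to it, the displayed polynomial $F\in\mathbb F_2[t,X]$ is symmetric in $t$ and $X$, and $\sigma_{S,m}$ is the unique solution in $\mathcal N(\mathbb F_2)$ of $F(t,X)=0$ of the form $t+t^{m+1}+O(t^{m+2})$. (1) For $m=1$: $$\sigma_{S,1}=t+\sum_{k\ge2}\left(t^{2^k-2}+t^{2^k-1}\right),\qquad F=(tX)^2+tX+X+t.$$ It is sparse of rank $1$, and it is produced by the $2$-automaton with states $a$ (start), $b,c,d,e$, outputs $0,1,0,1,0$ respectively, and edges $a\xrightarrow{1}b$, $a\xrightarrow{0}c$, $b\xrightarrow{1}b$, $b\xrightarrow{0}d$, $c\xrightarrow{1}b$, $c\xrightarrow{0}e$, $d\xrightarrow{0}d$, $d\xrightarrow{1}e$, $e\xrightarrow{0,1}e$. (2) For $m=2^\mu-1>1$: $$\sigma_{S,m}=t+\sum_{k\ge1}t^{\frac{m+1}{m-1}\left(m\left(\frac{m+1}{2}\right)^{k-1}-1\right)},\qquad F=(tX)^{2^{\mu-1}}+X+t.$$ It is sparse of rank $1$, and $E(\sigma_{S,m})$ consists of the integers whose base-$2$ representation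 is either $1$ or $10^{\mu-1}(10^{\mu-2})^\ell0$ for some $\ell\ge0$. It is produced by the $2$-automaton with the $\mu+3$ states $s$ (start), $p_0,\dots,p_{\mu-2}$, $c$, $d$, $e$, where $d$ has output $1$ and all other states have output $0$, with edges $s\xrightarrow{1}d$, $s\xrightarrow{0}p_0$, $p_i\xrightarrow{0}p_{i+1}$ $(0\le i<\mu-2)$, $p_{\mu-2}\xrightarrow{0}c$, $p_{\mu-2}\xrightarrow{1}p_0$, $c\xrightarrow{1}d$, $d\xrightarrow{0}d$, and all remaining edges leading to $e$. (3) For $m=2^\mu+1$: $$\sigma_{S,m}=\sum_{\substack{\emptyset\ne J\subseteq\{0,\dots,\mu-1\}\\ k\colon J\to\mathbb Z_{\ge0}}}t^{\left(\sum_{j\in J}2^j(m-1)^{k(j)}\right)m-m+1},\qquad F=(tX)^{2^\mu}+X^{2^\mu-1}+t^{2^\mu-1}.$$ It is sparse of rank $\mu$, and $E(\sigma_{S,m})$ consists precisely of the integers $m(\ell-1)+1$ with $\ell\ge1$ an integer whose base-$2$ expansion contains at most $\mu$ digits $1$, all at distinct positions modulo $\mu$. -/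

import Mathlib

open scoped PowerSeries.WithPiTopology

/-! ### The Nottingham group -/

/-- The underlying set of the Nottingham group over `R`: the power series `t + O(t^2)`. -/
@[ext]
structure Nottingham (R : Type*) [CommRing R] where
  toPowerSeries : PowerSeries R
  constantCoeff_eq : PowerSeries.constantCoeff toPowerSeries = 0
  coeff_one_eq : PowerSeries.coeff 1 toPowerSeries = 1

namespace Nottingham

variable {R : Type*} [CommRing R]

theorem hasSubst (σ : Nottingham R) : PowerSeries.HasSubst σ.toPowerSeries :=
  PowerSeries.HasSubst.of_constantCoeff_zero' σ.constantCoeff_eq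

theorem coeff_one_subst {f g : PowerSeries R} (hg : PowerSeries.constantCoeff g = 0) :
    PowerSeries.coeff 1 (f.subst g) = PowerSeries.coeff 1 f * PowerSeries.coeff 1 g := by
  rw [PowerSeries.coeff_subst' (PowerSeries.HasSubst.of_constantCoeff_zero' hg),
    finsum_eq_single _ 1]
  · simp
  · intro n hn
    rcases n with _ | _ | n
    · simp [PowerSeries.coeff_one]
    · exact absurd rfl hn
    · have : PowerSeries.coeff 1 (g ^ (n + 2)) = 0 := by
        apply PowerSeries.coeff_of_lt_order
        refine lt_of_lt_of_le ?_ (PowerSeries.le_order_pow_of_constantCoeff_eq_zero _ hg)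
        exact_mod_cast (by omega : 1 < n + 2)
      simp [this]

/-- The product `σ * τ` is the composition `σ(τ(t))`. -/
noncomputable instance : Mul (Nottingham R) where
  mul σ τ :=
    { toPowerSeries := σ.toPowerSeries.subst τ.toPowerSeries
      constantCoeff_eq :=
        PowerSeries.constantCoeff_subst_eq_zero τ.constantCoeff_eq _ σ.constantCoeff_eq
      coeff_one_eq := by
        rw [coeff_one_subst τ.constantCoeff_eq, σ.coeff_one_eq, τ.coeff_one_eq, one_mul] }

/-- The neutral element is the series `t`. -/
noncomputable instance : One (Nottingham R) where
  one := ⟨PowerSeries.X, PowerSeries.constantCoeff_X, PowerSeries.coeff_one_X⟩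

theorem isUnit_coeff_one (σ : Nottingham R) : IsUnit (PowerSeries.coeff 1 σ.toPowerSeries) := by
  rw [σ.coeff_one_eq]; exact isUnit_one

/-- The inverse is the compositional inverse. -/
noncomputable instance : Inv (Nottingham R) where
  inv σ :=
    { toPowerSeries := PowerSeries.substInvOfIsUnit σ.toPowerSeries σ.isUnit_coeff_one
      constantCoeff_eq := PowerSeries.constantCoeff_substInvOfIsUnit _ _
      coeff_one_eq := by
        rw [PowerSeries.coeff_one_substInvOfIsUnit]
        have h : σ.isUnit_coeff_one.unit = 1 := Units.ext σ.coeff_one_eq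
        rw [h]; simp }

theorem mul_toPowerSeries (σ τ : Nottingham R) :
    (σ * τ).toPowerSeries = σ.toPowerSeries.subst τ.toPowerSeries := rfl

/-- The Nottingham group: power series `t + O(t^2)` under composition. -/
noncomputable instance : Group (Nottingham R) :=
  Group.ofLeftAxioms
    (fun σ τ ρ => Nottingham.ext
      (PowerSeries.subst_comp_subst_apply τ.hasSubst ρ.hasSubst σ.toPowerSeries))
    (fun σ => Nottingham.ext (PowerSeries.subst_X σ.hasSubst))
    (fun σ => Nottingham.ext
      (PowerSeries.subst_substInvOfIsUnit_left σ.toPowerSeries σ.constantCoeff_eq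
        σ.isUnit_coeff_one))

/-- The depth `ord_t(σ(t) - t) - 1`, which is `⊤` for `σ = t`. -/
noncomputable def depth (σ : Nottingham R) : ℕ∞ :=
  (σ.toPowerSeries - PowerSeries.X).order - 1

/-- The (lower) break sequence `(d(σ), d(σ^2), …, d(σ^(2^(n-1))))` of an element `σ` of order
`2 ^ n`. -/
noncomputable def breakSequence (σ : Nottingham (ZMod 2)) : List ℕ∞ :=
  (List.range (Nat.log 2 (orderOf σ))).map fun i => (σ ^ 2 ^ i).depth

/-- `σ` represents the elements of order two with break sequence `(m)`: it is such an element, and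
every such element is conjugate to `σ` in the Nottingham group. -/
def RepresentsInvolutions (σ : Nottingham (ZMod 2)) (m : ℕ) : Prop :=
  (orderOf σ = 2 ∧ σ.breakSequence = [(m : ℕ∞)]) ∧
    ∀ ρ : Nottingham (ZMod 2), orderOf ρ = 2 → ρ.breakSequence = [(m : ℕ∞)] → IsConj ρ σ

/-- `σ(t) = t + t^(m+1) + O(t^(m+2))`. -/
def HasLeadingForm (σ : Nottingham (ZMod 2)) (m : ℕ) : Prop :=
  (PowerSeries.X : PowerSeries (ZMod 2)) ^ (m + 2) ∣
    σ.toPowerSeries - (PowerSeries.X + PowerSeries.X ^ (m + 1))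

/-- The value `F(t, σ(t))` of a polynomial `F` in two variables `t` (number `0`) and `X`
(number `1`). -/
noncomputable def evalPoly (F : MvPolynomial (Fin 2) (ZMod 2)) (σ : Nottingham (ZMod 2)) :
    PowerSeries (ZMod 2) :=
  MvPolynomial.aeval ![(PowerSeries.X : PowerSeries (ZMod 2)), σ.toPowerSeries] F

/-- `F(t, X)` is symmetric in `t` and `X`, and `σ` is the unique solution of `F(t, X) = 0` in the
Nottingham group of the form `t + t^(m+1) + O(t^(m+2))`. -/
def IsUniqueSymmetricSolution (F : MvPolynomial (Fin 2) (ZMod 2)) (m : ℕ)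
    (σ : Nottingham (ZMod 2)) : Prop :=
  F.IsSymmetric ∧ (σ.HasLeadingForm m ∧ evalPoly F σ = 0) ∧
    ∀ ρ : Nottingham (ZMod 2), ρ.HasLeadingForm m → evalPoly F ρ = 0 → ρ = σ

end Nottingham

/-! ### Supports and sparseness -/

/-- The support `E(f)`: the set of exponents that occur in `f`. -/
def seriesSupport (f : PowerSeries (ZMod 2)) : Set ℕ :=
  {k | PowerSeries.coeff k f ≠ 0}

/-- The real numbers `r ≥ 0` with `#(E(f) ∩ {0, …, N}) = O(log(N)^r)`. -/
def sparsenessExponents (f : PowerSeries (ZMod 2)) : Set ℝ :=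
  {r | 0 ≤ r ∧ (fun N : ℕ => ((seriesSupport f ∩ Set.Iic N).ncard : ℝ))
    =O[Filter.atTop] fun N : ℕ => Real.log N ^ r}

/-- A power series is sparse if `#(E(f) ∩ {0, …, N}) = O(log(N)^r)` for some `r ≥ 0`. -/
def IsSparse (f : PowerSeries (ZMod 2)) : Prop :=
  (sparsenessExponents f).Nonempty

/-- The rank of sparseness of a sparse power series. -/
noncomputable def sparsenessRank (f : PowerSeries (ZMod 2)) : ℝ :=
  sInf (sparsenessExponents f)

/-- The base-2 expansion of `k`, most significant digit first, with no leading zeros; the digits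
`1` and `0` are `true` and `false`. -/
def binaryWord (k : ℕ) : List Bool :=
  k.bits.reverse

/-- The binary word `1 0^(μ-1) (1 0^(μ-2))^l 0`. -/
def supportWord (μ l : ℕ) : List Bool :=
  true :: List.replicate (μ - 1) false ++
    (List.replicate l (true :: List.replicate (μ - 2) false)).flatten ++ [false]

/-- The positions of the digit `1` in the base-2 expansion of `l` (position `i` has weight
`2 ^ i`). -/
def onePositions (l : ℕ) : Set ℕ :=
  {i | l.testBit i = true}

/-- The exponent `(m+1)/(m-1) * (m * ((m+1)/2)^(k-1) - 1)`, for `m ≥ 3` odd and `k ≥ 1`. The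
division is exact, see `minusExponent_cast`. -/
def minusExponent (m k : ℕ) : ℕ :=
  (m + 1) * (m * ((m + 1) / 2) ^ (k - 1) - 1) / (m - 1)

theorem minusExponent_cast (m k : ℕ) (hm : 3 ≤ m) (hodd : Odd m) :
    (minusExponent m k : ℚ) =
      ((m : ℚ) + 1) / ((m : ℚ) - 1) * ((m : ℚ) * (((m : ℚ) + 1) / 2) ^ (k - 1) - 1) := by
  obtain ⟨a, rfl⟩ := hodd
  have h1 : (2 * a + 1 + 1) / 2 = a + 1 := by omega
  obtain ⟨b, hb⟩ : a ∣ (a + 1) ^ (k - 1) - 1 := by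
    simpa using Nat.sub_dvd_pow_sub_pow (a + 1) 1 (k - 1)
  have hpos : 1 ≤ (a + 1) ^ (k - 1) := Nat.one_le_pow _ _ (by omega)
  have hc : (a + 1) ^ (k - 1) = a * b + 1 := by omega
  have key : minusExponent (2 * a + 1) k = (a + 1) * (2 * (a * b + 1) + b) := by
    unfold minusExponent
    rw [h1, hc]
    have e : (2 * a + 1) * (a * b + 1) - 1 = a * (2 * (a * b + 1) + b) := by
      have : (2 * a + 1) * (a * b + 1) = a * (2 * (a * b + 1) + b) + 1 := by ring
      omega
    rw [e, show 2 * a + 1 - 1 = 2 * a by omega]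
    apply Nat.div_eq_of_eq_mul_left (by omega)
    ring
  have hq : (((2 * a + 1 : ℕ) : ℚ) + 1) / 2 = (a : ℚ) + 1 := by push_cast; ring
  have hcq : ((a : ℚ) + 1) ^ (k - 1) = a * b + 1 := by exact_mod_cast hc
  have ha : (a : ℚ) ≠ 0 := by
    have : a ≠ 0 := by omega
    exact_mod_cast this
  rw [key, hq, hcq]
  push_cast
  field_simp
  ring

/-- The pairs `(J, k)` of a nonempty subset `J` of `{0, …, μ-1}` and a map `k` from `J` to the
natural numbers. -/
abbrev PlusIndex (μ : ℕ) : Type :=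
  Σ J : {J : Finset (Fin μ) // J.Nonempty}, ({j // j ∈ J.1} → ℕ)

/-- The exponent `(∑_{j ∈ J} 2^j (m-1)^(k(j))) m - m + 1`. -/
def plusExponent {μ : ℕ} (m : ℕ) (p : PlusIndex μ) : ℕ :=
  (∑ j : {j // j ∈ p.1.1}, 2 ^ (j.1 : ℕ) * (m - 1) ^ p.2 j) * m - m + 1

/-! ### The polynomials, in the variables `t` (number `0`) and `X` (number `1`) -/

/-- `F(t, X) = (tX)^2 + tX + X + t`. -/
noncomputable def polyOne : MvPolynomial (Fin 2) (ZMod 2) :=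
  (MvPolynomial.X 0 * MvPolynomial.X 1) ^ 2 + MvPolynomial.X 0 * MvPolynomial.X 1 +
    MvPolynomial.X 1 + MvPolynomial.X 0

/-- `F(t, X) = (tX)^(2^(μ-1)) + X + t`. -/
noncomputable def polyMinus (μ : ℕ) : MvPolynomial (Fin 2) (ZMod 2) :=
  (MvPolynomial.X 0 * MvPolynomial.X 1) ^ 2 ^ (μ - 1) + MvPolynomial.X 1 + MvPolynomial.X 0

/-- `F(t, X) = (tX)^(2^μ) + X^(2^μ-1) + t^(2^μ-1)`. -/
noncomputable def polyPlus (μ : ℕ) : MvPolynomial (Fin 2) (ZMod 2) :=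
  (MvPolynomial.X 0 * MvPolynomial.X 1) ^ 2 ^ μ + MvPolynomial.X 1 ^ (2 ^ μ - 1) +
    MvPolynomial.X 0 ^ (2 ^ μ - 1)

/-! ### Automata -/

/-- A 2-automaton: a deterministic finite automaton with input digits `0` and `1` (`false` and
`true`) and output in `𝔽₂`, all of whose states are accessible, and such that an edge with label
`0` connects states with the same output. -/
structure TwoAutomaton where
  State : Type
  finite : Finite State
  start : State
  step : State → Bool → State
  output : State → ZMod 2
  accessible : ∀ v : State, ∃ w : List Bool, w.foldl step start = v
  leadingZeros : ∀ v : State, output (step v false) = output v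

/-- The power series whose `k`-th coefficient is the output of the state reached by reading the
base-2 digits of `k`, starting from the least significant one. -/
noncomputable def TwoAutomaton.series (A : TwoAutomaton) : PowerSeries (ZMod 2) :=
  PowerSeries.mk fun k => A.output (k.bits.foldl A.step A.start)

/-- States of the automaton for `m = 1`. -/
inductive StateOne : Type
  | start | ones | zero | done | sink

/-- The 5-state automaton for `m = 1`. -/
def automatonOne : TwoAutomaton where
  State := StateOne
  finite := Finite.of_surjective
    (fun i : Fin 5 => match i with
      | 0 => StateOne.start | 1 => .ones | 2 => .zero | 3 => .done | 4 => .sink)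
    (by rintro (_ | _ | _ | _ | _)
        exacts [⟨0, rfl⟩, ⟨1, rfl⟩, ⟨2, rfl⟩, ⟨3, rfl⟩, ⟨4, rfl⟩])
  start := .start
  step
    | .start, true => .ones
    | .start, false => .zero
    | .ones, true => .ones
    | .ones, false => .done
    | .zero, true => .ones
    | .zero, false => .sink
    | .done, true => .sink
    | .done, false => .done
    | .sink, _ => .sink
  output
    | .start => 0
    | .ones => 1
    | .zero => 0
    | .done => 1
    | .sink => 0
  accessible := by
    rintro (_ | _ | _ | _ | _)
    exacts [⟨[], rfl⟩, ⟨[true], rfl⟩, ⟨[false], rfl⟩, ⟨[true, false], rfl⟩,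
      ⟨[false, false], rfl⟩]
  leadingZeros := by rintro (_ | _ | _ | _ | _) <;> rfl

/-- States of the automaton for `m = 2^μ - 1 ≥ 3`: the start state, a path of `μ - 1` states, and
three further states. -/
inductive StateMinus (μ : ℕ) : Type
  | start
  | path (i : Fin (μ - 1))
  | last
  | done
  | sink

/-- Transitions for `m = 2^μ - 1 ≥ 3`: from the start state, `1` leads to `done` and `0` to the first
state of the path; `0` leads along the path and from its final state to `last`; `1` leads from the
final state of the path to its first state and from `last` to `done`; `0` fixes `done`; all other
edges lead to the absorbing state `sink`. -/
def stepMinus (μ : ℕ) (hμ : 2 ≤ μ) : StateMinus μ → Bool → StateMinus μ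
  | .start, true => .done
  | .start, false => .path ⟨0, by omega⟩
  | .path i, true => if i.1 + 1 = μ - 1 then .path ⟨0, by omega⟩ else .sink
  | .path i, false => if h : i.1 + 1 < μ - 1 then .path ⟨i.1 + 1, h⟩ else .last
  | .last, true => .done
  | .last, false => .sink
  | .done, true => .sink
  | .done, false => .done
  | .sink, _ => .sink

theorem stepMinus_path (μ : ℕ) (hμ : 2 ≤ μ) (i : ℕ) (h : i < μ - 1) :
    (List.replicate (i + 1) false).foldl (stepMinus μ hμ) .start = .path ⟨i, h⟩ := by
  induction i with
  | zero => rfl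
  | succ n ih =>
    rw [List.replicate_succ', List.foldl_append, ih (by omega)]
    exact dif_pos h

/-- The automaton with `μ + 3` states for `m = 2^μ - 1 ≥ 3`, where `μ ≥ 2`. -/
def automatonMinus (μ : ℕ) (hμ : 2 ≤ μ) : TwoAutomaton where
  State := StateMinus μ
  finite := Finite.of_surjective
    (fun x : Fin (μ - 1) ⊕ Fin 4 => match x with
      | .inl i => StateMinus.path i
      | .inr 0 => .start | .inr 1 => .last | .inr 2 => .done | .inr 3 => .sink)
    (by rintro (_ | i | _ | _ | _)
        exacts [⟨.inr 0, rfl⟩, ⟨.inl i, rfl⟩, ⟨.inr 1, rfl⟩, ⟨.inr 2, rfl⟩, ⟨.inr 3, rfl⟩])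
  start := .start
  step := stepMinus μ hμ
  output
    | .done => 1
    | _ => 0
  accessible := by
    rintro (_ | i | _ | _ | _)
    · exact ⟨[], rfl⟩
    · exact ⟨_, stepMinus_path μ hμ i.1 i.2⟩
    · refine ⟨List.replicate (μ - 2 + 1) false ++ [false], ?_⟩
      rw [List.foldl_append, stepMinus_path μ hμ (μ - 2) (by omega)]
      exact dif_neg (by simp only; omega)
    · exact ⟨[true], rfl⟩
    · exact ⟨[true, true], rfl⟩
  leadingZeros := by
    rintro (_ | i | _ | _ | _)
    · rfl
    · simp only [stepMinus]; split_ifs <;> rfl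
    · rfl
    · rfl
    · rfl

/-! Conjugacy. Let `σ` be an involution of odd depth `m`. Since `m` is odd, `σ = t(1 + u^m)` for
some `u` in the group. Substituting `σ` into this identity gives `(1 + u^m)(1 + (u∘σ)^m) = 1`, so `τ
= u σ u⁻¹` satisfies `(1 + t^m) τ^m = t^m`. This determines `τ`, because `m`-th powers are injective
on the group. Hence all involutions of depth `m` are conjugate (`Nottingham.isConj_of_mul_self`).

Order two. If `F` is symmetric and `F(t, σ) = 0`, substituting `σ⁻¹` shows that `σ⁻¹` is also a
root. Uniqueness of the root then forces `σ⁻¹ = σ`. Each case therefore reduces to uniqueness,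
proved by factoring `F(t, σ) - F(t, τ)` and cancelling a nonzero factor, and to checking that an
explicit series is a root.

Explicit roots. Frobenius acts termwise on series over `𝔽₂`, so self-similar exponent sets give
algebraic equations. For `m = 1` use `A = ∑ t^(2^k)` over `k ≥ 2`, with `A^2 = A + t^4`. For `m = 2q
- 1` with `q = 2^(μ-1)`, the exponents of `T = σ - t` follow `e ↦ q(e + 1)`, giving `T = t^(2q) +
t^q T^q`. For `m = q + 1` with `q = 2^μ`, put `B = 1 + ∑ t^(m q^k)`. Then `B^q = B + t^m`, `σ = t /
B`, and `t^q σ = B^(q-1) + 1`. Expanding `B^(q-1) = ∏_{j<μ} B^(2^j)` yields exactly the numbers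
whose binary digits 1 have positions distinct modulo `μ`.

The ranks follow from counting these exponents below powers of 2 and along geometric sequences
(`isSparse_and_sparsenessRank_eq`). The automata are analysed state by state. -/

namespace Nottingham

/-! ### Substitution as an algebra homomorphism -/

section CommRing

variable {R : Type*} [CommRing R]

/-- Substitution of an element of the Nottingham group, as an algebra homomorphism. -/
noncomputable def comp (τ : Nottingham R) : PowerSeries R →ₐ[R] PowerSeries R :=
  PowerSeries.substAlgHom τ.hasSubst

theorem mul_eq_comp (σ τ : Nottingham R) :
    (σ * τ).toPowerSeries = τ.comp σ.toPowerSeries := by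
  rw [comp, PowerSeries.coe_substAlgHom]; rfl

theorem one_toPowerSeries : (1 : Nottingham R).toPowerSeries = PowerSeries.X := rfl

theorem comp_X (τ : Nottingham R) : τ.comp PowerSeries.X = τ.toPowerSeries := by
  rw [comp, PowerSeries.coe_substAlgHom, PowerSeries.subst_X τ.hasSubst]

theorem exists_eq_X_mul (σ : Nottingham R) :
    ∃ v : PowerSeries R, PowerSeries.constantCoeff v = 1 ∧
      σ.toPowerSeries = PowerSeries.X * v := by
  obtain ⟨v, hv⟩ := PowerSeries.X_dvd_iff.2 σ.constantCoeff_eq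
  refine ⟨v, ?_, hv⟩
  have h := σ.coeff_one_eq
  rw [hv, show (1 : ℕ) = 0 + 1 from rfl, PowerSeries.coeff_succ_X_mul] at h
  simpa using h

/-- The element `X * v` of the Nottingham group, for a series `v` with constant term `1`. -/
noncomputable def ofXMul (v : PowerSeries R) (hv : PowerSeries.constantCoeff v = 1) :
    Nottingham R where
  toPowerSeries := PowerSeries.X * v
  constantCoeff_eq := by simp
  coeff_one_eq := by
    rw [show (1 : ℕ) = 0 + 1 from rfl, PowerSeries.coeff_succ_X_mul]; simpa using hv

end CommRing

/-! ### Conjugacy and order of involutions over `𝔽₂` -/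

section Char2

open PowerSeries

theorem natCast_zmod_two_of_odd {m : ℕ} (hm : Odd m) : (m : ZMod 2) = 1 :=
  ZMod.natCast_eq_one_iff_odd.2 hm

theorem series_add_self (f : PowerSeries (ZMod 2)) : f + f = 0 := by
  ext n; simpa using CharTwo.add_self_eq_zero _

instance : CharP (PowerSeries (ZMod 2)) 2 :=
  charP_of_injective_algebraMap (R := ZMod 2) (algebraMap (ZMod 2) (PowerSeries (ZMod 2))).injective 2

/-- For odd `m` the series `(1 + X)^m - 1` lies in the Nottingham group. Its compositional inverse
gives an `m`-th root of `1 + X`, into which `f - 1` is substituted. -/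
theorem exists_pow_eq {m : ℕ} (hm : Odd m) (f : PowerSeries (ZMod 2))
    (hf : constantCoeff f = 1) :
    ∃ r : PowerSeries (ZMod 2), constantCoeff r = 1 ∧ r ^ m = f := by
  let g : Nottingham (ZMod 2) :=
    { toPowerSeries := (1 + X) ^ m - 1
      constantCoeff_eq := by simp
      coeff_one_eq := by
        rw [map_sub, coeff_one_pow]
        simp [coeff_one, natCast_zmod_two_of_odd hm] }
  have hg : (1 + (g⁻¹).toPowerSeries) ^ m = 1 + X := by
    have h := congrArg toPowerSeries (mul_inv_cancel g)
    rw [mul_eq_comp, one_toPowerSeries] at h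
    simp only [g, map_sub, map_pow, map_add, map_one, comp_X] at h
    rw [← h]; ring
  have hs : HasSubst (f - 1) :=
    HasSubst.of_constantCoeff_zero' (by simp [hf])
  refine ⟨substAlgHom hs (1 + (g⁻¹).toPowerSeries), ?_, ?_⟩
  · rw [map_add, map_one, map_add, map_one, coe_substAlgHom]
    have : constantCoeff (subst (f - 1) (g⁻¹).toPowerSeries) = 0 :=
      constantCoeff_subst_eq_zero (a := f - 1)
        (show constantCoeff (f - 1) = 0 by simp [hf]) _ (g⁻¹).constantCoeff_eq
    rw [this, add_zero]
  · rw [← map_pow, hg, map_add, map_one, coe_substAlgHom, subst_X hs]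
    ring

theorem constantCoeff_geomSum₂ {m : ℕ} (hm : Odd m) {a b : PowerSeries (ZMod 2)}
    (ha : constantCoeff a = 1) (hb : constantCoeff b = 1) :
    constantCoeff (∑ i ∈ Finset.range m, a ^ i * b ^ (m - 1 - i)) = 1 := by
  simp [ha, hb, natCast_zmod_two_of_odd hm]

theorem ne_zero_of_constantCoeff {a : PowerSeries (ZMod 2)} (ha : constantCoeff a = 1) :
    a ≠ 0 := by
  rintro rfl; simp at ha

/-- The cofactor of `a - b` in `a^m - b^m` has constant term `m = 1` in `𝔽₂`, so it can be
cancelled. -/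
theorem pow_left_injective_of_odd {m : ℕ} (hm : Odd m) {a b : PowerSeries (ZMod 2)}
    (ha : constantCoeff a = 1) (hb : constantCoeff b = 1) (h : a ^ m = b ^ m) : a = b := by
  have h1 := (Commute.all a b).geom_sum₂_mul m
  rw [h, sub_self] at h1
  exact sub_eq_zero.1
    ((mul_eq_zero.1 h1).resolve_left (ne_zero_of_constantCoeff (constantCoeff_geomSum₂ hm ha hb)))

theorem ext_of_pow_eq {m : ℕ} (hm : Odd m) {σ τ : Nottingham (ZMod 2)}
    (h : σ.toPowerSeries ^ m = τ.toPowerSeries ^ m) : σ = τ := by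
  obtain ⟨v, hv, hσ⟩ := σ.exists_eq_X_mul
  obtain ⟨w, hw, hτ⟩ := τ.exists_eq_X_mul
  rw [hσ, hτ, mul_pow, mul_pow] at h
  have := pow_left_injective_of_odd hm hv hw (mul_left_cancel₀ (pow_ne_zero _ X_ne_zero) h)
  apply Nottingham.ext
  rw [hσ, hτ, this]

theorem hasLeadingForm_iff_exists {σ : Nottingham (ZMod 2)} {m : ℕ} :
    σ.HasLeadingForm m ↔ ∃ v : PowerSeries (ZMod 2), constantCoeff v = 1 ∧
      σ.toPowerSeries = X + X ^ (m + 1) * v := by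
  constructor
  · rintro ⟨c, hc⟩
    refine ⟨1 + X * c, by simp, ?_⟩
    rw [sub_eq_iff_eq_add.1 hc]; ring
  · rintro ⟨v, hv, hσ⟩
    obtain ⟨c, hc⟩ := X_dvd_iff.2 (show constantCoeff (v - 1) = 0 by simp [hv])
    refine ⟨c, ?_⟩
    rw [hσ, sub_eq_iff_eq_add.1 hc]; ring

theorem hasLeadingForm_iff_depth {σ : Nottingham (ZMod 2)} {m : ℕ} (hm : 1 ≤ m) :
    σ.HasLeadingForm m ↔ σ.depth = m := by
  -- The subtraction in `depth` is truncated; `1 ≤ m` excludes order 0.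
  have h1 : σ.depth = m ↔ (σ.toPowerSeries - X).order = ((m + 1 : ℕ) : ℕ∞) := by
    rw [depth]
    generalize (σ.toPowerSeries - X).order = o
    cases o with
    | top => simpa using ENat.top_ne_natCast (m + 1)
    | coe o =>
      norm_cast
      omega
  rw [h1, hasLeadingForm_iff_exists]
  constructor
  · rintro ⟨v, hv, hσ⟩
    rw [hσ, add_sub_cancel_left, order_eq_nat]
    refine ⟨by rw [coeff_X_pow_mul']; simp [hv], fun i hi => ?_⟩
    rw [coeff_X_pow_mul', if_neg (by omega)]
  · intro h
    obtain ⟨h2, h3⟩ := order_eq_nat.1 h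
    obtain ⟨v, hv⟩ := X_pow_dvd_iff.2 h3
    refine ⟨v, ?_, ?_⟩
    · rw [hv, coeff_X_pow_mul'] at h2
      simp only [le_refl, if_true, Nat.sub_self, coeff_zero_eq_constantCoeff] at h2
      have : ∀ x : ZMod 2, x ≠ 0 → x = 1 := by decide
      exact this _ h2
    · rw [← hv]; ring

theorem breakSequence_of_orderOf {σ : Nottingham (ZMod 2)} (h : orderOf σ = 2) :
    σ.breakSequence = [σ.depth] := by
  have : Nat.log 2 2 = 1 := by norm_num
  simp [breakSequence, h, this]

/-- An involution of odd depth `m` is conjugate to the series `τ` with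
`τ ^ m = X ^ m / (1 + X ^ m)`. -/
theorem exists_isConj_of_mul_self {m : ℕ} (hm : Odd m) {σ : Nottingham (ZMod 2)}
    (h2 : σ * σ = 1) (hd : σ.HasLeadingForm m) :
    ∃ τ : Nottingham (ZMod 2), IsConj σ τ ∧ (1 + X ^ m) * τ.toPowerSeries ^ m = X ^ m := by
  obtain ⟨v, hv, hσ⟩ := hasLeadingForm_iff_exists.1 hd
  obtain ⟨r, hr, hrv⟩ := exists_pow_eq hm v hv
  let u := ofXMul r hr
  have hu : u.toPowerSeries ^ m = X ^ m * v := by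
    change (X * r) ^ m = _
    rw [mul_pow, hrv]
  have hσ' : σ.toPowerSeries = X * (1 + u.toPowerSeries ^ m) := by rw [hσ, hu]; ring
  have key : (1 + u.toPowerSeries ^ m) * (u * σ).toPowerSeries ^ m = u.toPowerSeries ^ m := by
    -- Substituting `σ` into `σ = X (1 + u^m)` and using `σ * σ = 1` gives `(1 + u^m)(1 + (u∘σ)^m) =
    -- 1` after cancelling `X`; `key` is its expansion in characteristic 2.
    have h := congrArg σ.comp hσ'
    rw [← mul_eq_comp, h2, one_toPowerSeries, map_mul, comp_X, map_add, map_one, map_pow,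
      ← mul_eq_comp, hσ', mul_assoc] at h
    have h' := mul_left_cancel₀ X_ne_zero ((mul_one X).trans h)
    linear_combination -h' - series_add_self (u.toPowerSeries ^ m)
  refine ⟨u * σ * u⁻¹, isConj_iff.2 ⟨u, rfl⟩, ?_⟩
  have h := congrArg (u⁻¹).comp key
  simp only [map_mul, map_add, map_one, map_pow, ← mul_eq_comp, mul_inv_cancel,
    one_toPowerSeries] at h
  exact h

theorem isConj_of_mul_self {m : ℕ} (hm : Odd m) {σ ρ : Nottingham (ZMod 2)}
    (hσ : σ * σ = 1) (hρ : ρ * ρ = 1) (hσm : σ.HasLeadingForm m) (hρm : ρ.HasLeadingForm m) :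
    IsConj σ ρ := by
  obtain ⟨τ, h1, h2⟩ := exists_isConj_of_mul_self hm hσ hσm
  obtain ⟨τ', h3, h4⟩ := exists_isConj_of_mul_self hm hρ hρm
  have hne : (1 + X ^ m : PowerSeries (ZMod 2)) ≠ 0 :=
    ne_zero_of_constantCoeff (by simp [hm.pos.ne'])
  have : τ = τ' := ext_of_pow_eq hm (mul_left_cancel₀ hne (h2.trans h4.symm))
  subst this
  exact h1.trans h3.symm

theorem representsInvolutions_of_mul_self {m : ℕ} (hm : Odd m) {σ : Nottingham (ZMod 2)}
    (hσ : σ * σ = 1) (hσm : σ.HasLeadingForm m) : σ.RepresentsInvolutions m := by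
  have hd := (hasLeadingForm_iff_depth hm.pos).1 hσm
  have hne : σ ≠ 1 := by
    rintro rfl
    rw [depth, one_toPowerSeries, sub_self, order_zero] at hd
    simp at hd
  have ho : orderOf σ = 2 := orderOf_eq_prime (by rw [pow_two, hσ]) hne
  refine ⟨⟨ho, by rw [breakSequence_of_orderOf ho, hd]⟩, fun ρ hρ hb => ?_⟩
  rw [breakSequence_of_orderOf hρ, List.cons.injEq] at hb
  refine isConj_of_mul_self hm ?_ hσ ((hasLeadingForm_iff_depth hm.pos).2 hb.1) hσm
  rw [← pow_two]
  exact orderOf_dvd_iff_pow_eq_one.1 hρ.dvd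

/-- Substituting `σ⁻¹` into `σ = X + X^(m+1) v` expresses `X` through `σ⁻¹`; in characteristic 2 the
sign of the correction term does not matter. -/
theorem HasLeadingForm.inv {m : ℕ} {σ : Nottingham (ZMod 2)} (h : σ.HasLeadingForm m) :
    (σ⁻¹).HasLeadingForm m := by
  obtain ⟨v, hv, hσ⟩ := hasLeadingForm_iff_exists.1 h
  obtain ⟨w, hw, hσi⟩ := (σ⁻¹).exists_eq_X_mul
  have h1 := congrArg (σ⁻¹).comp hσ
  rw [← mul_eq_comp, mul_inv_cancel, one_toPowerSeries, map_add, map_mul, map_pow, comp_X] at h1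
  refine hasLeadingForm_iff_exists.2 ⟨w ^ (m + 1) * (σ⁻¹).comp v, ?_, ?_⟩
  · obtain ⟨c, hc⟩ := X_dvd_iff.2 (show constantCoeff (v - 1) = 0 by simp [hv])
    rw [sub_eq_iff_eq_add.1 hc, map_add (σ⁻¹).comp, map_one, map_mul (σ⁻¹).comp, comp_X]
    simp [hw, (σ⁻¹).constantCoeff_eq]
  · have h0 := series_add_self ((σ⁻¹).toPowerSeries ^ (m + 1) * (σ⁻¹).comp v)
    have h3 : (σ⁻¹).toPowerSeries ^ (m + 1) = X ^ (m + 1) * w ^ (m + 1) := by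
      rw [hσi, mul_pow]
    linear_combination (σ⁻¹).comp v * h3 - h0 - h1

/-- Substituting `σ⁻¹` into `F(t, σ) = 0` gives `F(σ⁻¹, t) = 0`, and symmetry exchanges the
arguments. -/
theorem evalPoly_inv {F : MvPolynomial (Fin 2) (ZMod 2)} (hF : F.IsSymmetric)
    {σ : Nottingham (ZMod 2)} (h : evalPoly F σ = 0) : evalPoly F σ⁻¹ = 0 := by
  have h1 := congrArg (σ⁻¹).comp h
  rw [map_zero, evalPoly, ← AlgHom.comp_apply, MvPolynomial.comp_aeval] at h1
  rw [evalPoly, ← hF (Equiv.swap 0 1), MvPolynomial.aeval_rename, ← h1]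
  congr 2
  funext i
  fin_cases i
  · simp [comp_X]
  · simp [← mul_eq_comp, one_toPowerSeries]

theorem IsUniqueSymmetricSolution.representsInvolutions {F : MvPolynomial (Fin 2) (ZMod 2)}
    {m : ℕ} (hm : Odd m) {σ : Nottingham (ZMod 2)} (h : σ.IsUniqueSymmetricSolution F m) :
    σ.RepresentsInvolutions m := by
  refine representsInvolutions_of_mul_self hm ?_ h.2.1.1
  have : σ⁻¹ = σ := h.2.2 _ h.2.1.1.inv (evalPoly_inv h.1 h.2.1.2)
  nth_rw 1 [← this]
  exact inv_mul_cancel σ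

end Char2

end Nottingham

/-! ### Series over `𝔽₂` determined by their support -/

section IndicatorSeries

open PowerSeries

open Classical in
/-- The power series over `𝔽₂` with support `S`. -/
noncomputable def indicatorSeries (S : Set ℕ) : PowerSeries (ZMod 2) :=
  PowerSeries.mk fun n => if n ∈ S then 1 else 0

open Classical in
theorem coeff_indicatorSeries (S : Set ℕ) (n : ℕ) :
    coeff n (indicatorSeries S) = if n ∈ S then 1 else 0 := coeff_mk _ _

theorem seriesSupport_indicatorSeries (S : Set ℕ) : seriesSupport (indicatorSeries S) = S := by
  ext n; simp [seriesSupport, coeff_indicatorSeries]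

/-- Injectivity rules out cancellation modulo 2: each coefficient receives at most one term. -/
theorem hasSum_indicatorSeries {ι : Type*} {e : ι → ℕ} (he : Function.Injective e) :
    HasSum (fun i => (X ^ e i : PowerSeries (ZMod 2))) (indicatorSeries (Set.range e)) := by
  classical
  rw [WithPiTopology.hasSum_iff_hasSum_coeff]
  intro n
  rw [coeff_indicatorSeries]
  split_ifs with h
  · obtain ⟨i, rfl⟩ := h
    convert! hasSum_ite_eq i (1 : ZMod 2) using 2 with j
    simp [coeff_X_pow, he.eq_iff, eq_comm]
  · convert! hasSum_zero using 2 with j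
    rw [coeff_X_pow, if_neg fun h' => h ⟨j, h'.symm⟩]

theorem indicatorSeries_singleton (a : ℕ) : indicatorSeries {a} = X ^ a := by
  ext n; simp [coeff_indicatorSeries, coeff_X_pow]

theorem indicatorSeries_union {S T : Set ℕ} (h : Disjoint S T) :
    indicatorSeries (S ∪ T) = indicatorSeries S + indicatorSeries T := by
  ext n
  have : n ∈ S → n ∉ T := fun h' => Set.disjoint_left.1 h h'
  by_cases h1 : n ∈ S <;> by_cases h2 : n ∈ T <;> simp_all [coeff_indicatorSeries]

open scoped Pointwise in
-- The hypothesis says that sums from `S` and `T` decompose uniquely, so every coefficient of the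
-- product has at most one contribution.
theorem indicatorSeries_mul {S T : Set ℕ}
    (h : ∀ a ∈ S, ∀ b ∈ T, ∀ a' ∈ S, ∀ b' ∈ T, a + b = a' + b' → a = a') :
    indicatorSeries S * indicatorSeries T = indicatorSeries (S + T) := by
  classical
  ext n
  rw [coeff_mul, coeff_indicatorSeries]
  simp only [coeff_indicatorSeries]
  split_ifs with hn
  · obtain ⟨a, ha, b, hb, rfl⟩ := hn
    rw [Finset.sum_eq_single (a, b)]
    · simp [ha, hb]
    · rintro ⟨a', b'⟩ hab hne
      rw [Finset.HasAntidiagonal.mem_antidiagonal] at hab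
      by_contra hc
      obtain ⟨h1, h2⟩ : a' ∈ S ∧ b' ∈ T := by
        constructor <;> · by_contra h'; simp [h'] at hc
      have := h a' h1 b' h2 a ha b hb hab
      simp only at hab
      exact hne (Prod.ext this (by simp only; omega))
    · intro hc; simp at hc
  · refine Finset.sum_eq_zero fun x hx => ?_
    rw [Finset.HasAntidiagonal.mem_antidiagonal] at hx
    by_contra hc
    refine hn ⟨x.1, ?_, x.2, ?_, hx⟩ <;> · by_contra h'; simp [h'] at hc

/-- The iterated Frobenius is additive and continuous, hence commutes with infinite sums. -/
theorem hasSum_pow_two_pow {ι : Type*} {e : ι → ℕ} {f : PowerSeries (ZMod 2)}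
    (h : HasSum (fun i => (X ^ e i : PowerSeries (ZMod 2))) f) (j : ℕ) :
    HasSum (fun i => (X ^ (2 ^ j * e i) : PowerSeries (ZMod 2))) (f ^ 2 ^ j) := by
  convert! h.map (iterateFrobenius (PowerSeries (ZMod 2)) 2 j) (continuous_pow (2 ^ j)) using 2 with i
  simp [iterateFrobenius_def, ← pow_mul, mul_comm]

theorem indicatorSeries_range_pow_two_pow {ι : Type*} {e : ι → ℕ} (he : Function.Injective e)
    (j : ℕ) :
    indicatorSeries (Set.range e) ^ 2 ^ j = indicatorSeries (Set.range fun i => 2 ^ j * e i) :=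
  (hasSum_pow_two_pow (hasSum_indicatorSeries he) j).unique (hasSum_indicatorSeries fun _ _ h =>
    he (Nat.eq_of_mul_eq_mul_left (by positivity) h))

end IndicatorSeries

/-! ### Rank of sparseness from counting bounds -/

section Rank

open Filter

theorem natCast_mem_sparsenessExponents {f : PowerSeries (ZMod 2)} {d C : ℕ}
    (hup : ∀ N K : ℕ, N < 2 ^ K →
      (seriesSupport f ∩ Set.Iic N).ncard ≤ (C * (K + 1)) ^ d) :
    (d : ℝ) ∈ sparsenessExponents f := by
  refine ⟨by positivity, ?_⟩
  refine Asymptotics.IsBigO.of_bound ((C * (3 / Real.log 2)) ^ d) ?_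
  filter_upwards [eventually_ge_atTop 2] with N hN
  have hl2 : 0 < Real.log 2 := Real.log_pos (by norm_num)
  have hN' : (2 : ℝ) ≤ N := by exact_mod_cast hN
  have hlN : Real.log 2 ≤ Real.log N := Real.log_le_log (by norm_num) hN'
  -- With `K = Nat.log 2 N + 1`, the factor `K + 1` is at most `x + 2 ≤ 3x`, where `x = log N / log
  -- 2 ≥ 1`; this is the source of the constant 3.
  have h1 := hup N (Nat.log 2 N + 1) (Nat.lt_pow_succ_log_self (by norm_num) N)
  have h2 : (Nat.log 2 N : ℝ) ≤ Real.log N / Real.log 2 := by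
    rw [le_div_iff₀ hl2, ← Real.log_pow]
    refine Real.log_le_log (by positivity) ?_
    exact_mod_cast Nat.pow_log_le_self 2 (by omega)
  have h3 : (Nat.log 2 N : ℝ) + 2 ≤ 3 / Real.log 2 * Real.log N := by
    have : 1 ≤ Real.log N / Real.log 2 := (one_le_div hl2).2 hlN
    have e : 3 / Real.log 2 * Real.log N = 3 * (Real.log N / Real.log 2) := by ring
    rw [e]; linarith
  rw [Real.rpow_natCast, Real.norm_of_nonneg (by positivity),
    Real.norm_of_nonneg (pow_nonneg (hl2.le.trans hlN) d), ← mul_pow]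
  calc ((seriesSupport f ∩ Set.Iic N).ncard : ℝ)
      ≤ (((C * (Nat.log 2 N + 1 + 1)) ^ d : ℕ) : ℝ) := by exact_mod_cast h1
    _ = (C * ((Nat.log 2 N : ℝ) + 2)) ^ d := by push_cast; ring
    _ ≤ _ := by
      rw [mul_assoc]
      gcongr

/-- Along `N = c b^K` the logarithm is linear in `K`, so an exponent `r < d` would bound `K^d` by a
constant times `K^r` for large `K`. -/
theorem le_of_mem_sparsenessExponents {f : PowerSeries (ZMod 2)} {d b c : ℕ} (hb : 2 ≤ b)
    (hc : 1 ≤ c) (hlow : ∀ K : ℕ, K ^ d ≤ (seriesSupport f ∩ Set.Iic (c * b ^ K)).ncard)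
    {r : ℝ} (hr : r ∈ sparsenessExponents f) : (d : ℝ) ≤ r := by
  by_contra! hlt
  obtain ⟨hr0, hO⟩ := hr
  obtain ⟨A, hA⟩ := hO.bound
  have hb' : (2 : ℝ) ≤ b := by exact_mod_cast hb
  have hc' : (1 : ℝ) ≤ c := by exact_mod_cast hc
  have hlb : 0 < Real.log b := Real.log_pos (by linarith)
  have hlc : 0 ≤ Real.log c := Real.log_nonneg hc'
  have htend : Tendsto (fun K : ℕ => c * b ^ K) atTop atTop :=
    (tendsto_pow_atTop_atTop_of_one_lt (by omega : 1 < b)).const_mul_atTop' (by omega)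
  have h1 : Tendsto (fun K : ℕ => (K : ℝ) ^ ((d : ℝ) - r)) atTop atTop :=
    (tendsto_rpow_atTop (by linarith)).comp tendsto_natCast_atTop_atTop
  obtain ⟨K, hK1, hK2, hK3⟩ := ((htend.eventually hA).and
    ((h1.eventually_gt_atTop (A * (Real.log c + Real.log b) ^ r)).and
      (eventually_ge_atTop 1))).exists
  have hK : (1 : ℝ) ≤ K := by exact_mod_cast hK3
  have hlog : Real.log ((c * b ^ K : ℕ) : ℝ) = Real.log c + K * Real.log b := by
    push_cast
    rw [Real.log_mul (by positivity) (by positivity), Real.log_pow]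
  have hcount : (K : ℝ) ^ d ≤ (seriesSupport f ∩ Set.Iic (c * b ^ K)).ncard := by
    exact_mod_cast hlow K
  rw [hlog, Real.norm_of_nonneg (by positivity), Real.norm_of_nonneg (by positivity)] at hK1
  have hle : Real.log c + K * Real.log b ≤ (Real.log c + Real.log b) * K := by nlinarith
  have hKd : (0 : ℝ) < K ^ d := by positivity
  have hApos : 0 < A := by
    by_contra! hA0
    have : A * (Real.log c + K * Real.log b) ^ r ≤ 0 :=
      mul_nonpos_of_nonpos_of_nonneg hA0 (by positivity)
    linarith
  have h2 : (K : ℝ) ^ d ≤ A * (Real.log c + Real.log b) ^ r * (K : ℝ) ^ r := by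
    calc (K : ℝ) ^ d ≤ A * (Real.log c + K * Real.log b) ^ r := hcount.trans hK1
      _ ≤ A * ((Real.log c + Real.log b) * K) ^ r := by gcongr
      _ = _ := by rw [Real.mul_rpow (by positivity) (by positivity), mul_assoc]
  rw [Real.rpow_sub (by positivity), Real.rpow_natCast, lt_div_iff₀ (by positivity)] at hK2
  linarith

theorem isSparse_and_sparsenessRank_eq {f : PowerSeries (ZMod 2)} {d C b c : ℕ}
    (hup : ∀ N K : ℕ, N < 2 ^ K →
      (seriesSupport f ∩ Set.Iic N).ncard ≤ (C * (K + 1)) ^ d)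
    (hb : 2 ≤ b) (hc : 1 ≤ c)
    (hlow : ∀ K : ℕ, K ^ d ≤ (seriesSupport f ∩ Set.Iic (c * b ^ K)).ncard) :
    IsSparse f ∧ sparsenessRank f = d := by
  have h := natCast_mem_sparsenessExponents hup
  exact ⟨⟨_, h⟩, IsLeast.csInf_eq ⟨h, fun r hr => le_of_mem_sparsenessExponents hb hc hlow hr⟩⟩

end Rank

/-! ### Reading digits with an automaton -/

section Automata

/-- The exceptional case is `b = false`, `n = 0`: `Nat.bits` then lists no digit, and invariance of
the output under reading a zero fills the gap. -/
theorem TwoAutomaton.output_foldl_bits_bit (A : TwoAutomaton) (v : A.State) (b : Bool) (n : ℕ) :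
    A.output ((Nat.bit b n).bits.foldl A.step v) = A.output (n.bits.foldl A.step (A.step v b)) := by
  by_cases h : n = 0 → b = true
  · rw [Nat.bits_append_bit n b h, List.foldl_cons]
  · push Not at h
    obtain ⟨rfl, hb⟩ := h
    rw [Bool.eq_false_iff.2 hb]
    simp [Nat.bit, A.leadingZeros]

end Automata

open PowerSeries in
theorem X_pow_mul_indicatorSeries_range {ι : Type*} {e : ι → ℕ} (he : Function.Injective e)
    (a : ℕ) : X ^ a * indicatorSeries (Set.range e) = indicatorSeries (Set.range fun i => a + e i) := by
  have h := (hasSum_indicatorSeries he).mul_left (X ^ a)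
  simp only [← pow_add] at h
  exact h.unique (hasSum_indicatorSeries fun _ _ h => he (Nat.add_left_cancel h))

theorem TwoAutomaton.series_eq_indicatorSeries {A : TwoAutomaton} {S : Set ℕ}
    (h : ∀ n : ℕ, A.output (n.bits.foldl A.step A.start) = 1 ↔ n ∈ S) :
    A.series = indicatorSeries S := by
  have h01 : ∀ x : ZMod 2, x ≠ 1 → x = 0 := by decide
  ext n
  rw [TwoAutomaton.series, PowerSeries.coeff_mk, coeff_indicatorSeries]
  split_ifs with hn
  · exact (h n).2 hn
  · exact h01 _ fun h' => hn ((h n).1 h')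

theorem ncard_le_card_of_forall_exists {ι α : Type*} {S : Set α} (t : Finset ι) (f : ι → α)
    (h : ∀ n ∈ S, ∃ i ∈ t, f i = n) : S.ncard ≤ t.card := by
  classical
  calc S.ncard ≤ ((t.image f : Finset α) : Set α).ncard :=
        Set.ncard_le_ncard (fun n hn => by simpa using h n hn) (Finset.finite_toSet _)
    _ = (t.image f).card := Set.ncard_coe_finset _
    _ ≤ t.card := Finset.card_image_le

theorem card_le_ncard_of_injective {ι α : Type*} {S : Set α} (hS : S.Finite) (t : Finset ι)
    {f : ι → α} (hf : Function.Injective f) (h : ∀ i ∈ t, f i ∈ S) : t.card ≤ S.ncard := by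
  classical
  rw [← Finset.card_image_of_injective t hf, ← Set.ncard_coe_finset]
  exact Set.ncard_le_ncard (fun n hn => by
    obtain ⟨i, hi, rfl⟩ := Finset.mem_image.1 (Finset.mem_coe.1 hn); exact h i hi) hS

theorem isSymmetric_of_rename_swap {R : Type*} [CommSemiring R] {F : MvPolynomial (Fin 2) R}
    (h : MvPolynomial.rename (Equiv.swap 0 1) F = F) : F.IsSymmetric := by
  intro e
  have he : ∀ e : Equiv.Perm (Fin 2), e = Equiv.refl _ ∨ e = Equiv.swap 0 1 := by decide
  rcases he e with rfl | rfl
  · simp [MvPolynomial.rename_id]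
  · exact h

theorem two_eq_zero_series : (2 : PowerSeries (ZMod 2)) = 0 := CharTwo.two_eq_zero

/-! ### The case `m = 1` -/

namespace CaseOne

open PowerSeries

theorem isSymmetric : polyOne.IsSymmetric := by
  apply isSymmetric_of_rename_swap
  simp [polyOne]
  ring

theorem evalPoly_eq (σ : Nottingham (ZMod 2)) : Nottingham.evalPoly polyOne σ =
    (X * σ.toPowerSeries) ^ 2 + X * σ.toPowerSeries + σ.toPowerSeries + X := by
  simp [Nottingham.evalPoly, polyOne]

/-- The difference of the two equations is `σ - τ` times a series with constant term 1. -/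
theorem eq_of_evalPoly {σ τ : Nottingham (ZMod 2)} (hσ : Nottingham.evalPoly polyOne σ = 0)
    (hτ : Nottingham.evalPoly polyOne τ = 0) : σ = τ := by
  rw [evalPoly_eq] at hσ hτ
  have h : (σ.toPowerSeries - τ.toPowerSeries) *
      (1 + X * (1 + X * (σ.toPowerSeries + τ.toPowerSeries))) = 0 := by
    linear_combination hσ - hτ
  exact Nottingham.ext (sub_eq_zero.1 ((mul_eq_zero.1 h).resolve_right
    (Nottingham.ne_zero_of_constantCoeff (by simp))))

theorem hasLeadingForm_of_evalPoly {σ : Nottingham (ZMod 2)}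
    (hσ : Nottingham.evalPoly polyOne σ = 0) : σ.HasLeadingForm 1 := by
  rw [evalPoly_eq] at hσ
  obtain ⟨v, hv, hσv⟩ := σ.exists_eq_X_mul
  refine Nottingham.hasLeadingForm_iff_exists.2 ⟨v + X ^ 2 * v ^ 2, by simp [hv], ?_⟩
  rw [hσv] at hσ ⊢
  linear_combination hσ - (X + X ^ 2 * v + X ^ 4 * v ^ 2) * two_eq_zero_series

/-- The exponents `2 ^ k`, `k ≥ 2`, shifted down by `a`. -/
def expo (a : ℕ) (k : {k : ℕ // 2 ≤ k}) : ℕ := 2 ^ k.1 - a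

theorem four_le_two_pow (k : {k : ℕ // 2 ≤ k}) : 4 ≤ 2 ^ k.1 :=
  calc 4 = 2 ^ 2 := rfl
    _ ≤ _ := Nat.pow_le_pow_right (by norm_num) k.2

theorem expo_injective {a : ℕ} (ha : a ≤ 4) : Function.Injective (expo a) := by
  intro k l h
  have hk := four_le_two_pow k
  have hl := four_le_two_pow l
  simp only [expo] at h
  exact Subtype.ext (Nat.pow_right_injective le_rfl (by simp only; omega))

/-- The series `∑ t ^ (2 ^ k - a)`, over `k ≥ 2`. -/
noncomputable def tail (a : ℕ) : PowerSeries (ZMod 2) := indicatorSeries (Set.range (expo a))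

theorem X_pow_mul_tail {a : ℕ} (ha : a ≤ 4) : X ^ a * tail a = tail 0 := by
  rw [tail, X_pow_mul_indicatorSeries_range (expo_injective ha), tail]
  congr 3
  funext k
  have := four_le_two_pow k
  simp only [expo]; omega

/-- Squaring moves `2^k` to `2^(k+1)`, so only the term for `k = 2` is lost. -/
theorem tail_zero_sq : tail 0 ^ 2 = tail 0 + X ^ 4 := by
  have h := indicatorSeries_range_pow_two_pow (expo_injective (Nat.zero_le 4)) 1
  have hd : Disjoint (Set.range fun k => 2 ^ 1 * expo 0 k) {4} := by
    rw [Set.disjoint_singleton_right]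
    rintro ⟨k, hk⟩
    have := four_le_two_pow k
    simp only [expo] at hk; omega
  have hu : (Set.range fun k => 2 ^ 1 * expo 0 k) ∪ {4} = Set.range (expo 0) := by
    ext n
    constructor
    · rintro (⟨k, rfl⟩ | rfl)
      · exact ⟨⟨k.1 + 1, by omega⟩, by simp [expo, pow_succ, mul_comm]⟩
      · exact ⟨⟨2, le_rfl⟩, rfl⟩
    · rintro ⟨⟨k, hk⟩, rfl⟩
      obtain rfl | hk' := hk.eq_or_lt
      · right; rfl
      · left
        obtain ⟨l, rfl⟩ := Nat.exists_eq_add_of_lt hk'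
        exact ⟨⟨2 + l, by omega⟩, by simp only [expo, pow_succ]; omega⟩
  have h2 := indicatorSeries_union hd
  rw [hu, ← h, indicatorSeries_singleton, pow_one] at h2
  rw [tail]
  linear_combination -h2 - X ^ 4 * two_eq_zero_series

/-- The series `t + ∑ (t ^ (2 ^ k - 2) + t ^ (2 ^ k - 1))`, over `k ≥ 2`. -/
noncomputable def sigma : Nottingham (ZMod 2) where
  toPowerSeries := X + (tail 2 + tail 1)
  constantCoeff_eq := by
    rw [← coeff_zero_eq_constantCoeff_apply, tail, tail]
    simp only [map_add, coeff_indicatorSeries]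
    rw [if_neg, if_neg]
    · simp
    all_goals
      rintro ⟨k, hk⟩
      have := four_le_two_pow k
      simp only [expo] at hk; omega
  coeff_one_eq := by
    rw [tail, tail]
    simp only [map_add, coeff_indicatorSeries]
    rw [if_neg, if_neg]
    · simp
    all_goals
      rintro ⟨k, hk⟩
      have := four_le_two_pow k
      simp only [expo] at hk; omega

theorem evalPoly_sigma : Nottingham.evalPoly polyOne sigma = 0 := by
  have h1 := X_pow_mul_tail (a := 1) (by norm_num)
  have h2 := X_pow_mul_tail (a := 2) (by norm_num)
  have h3 := tail_zero_sq
  set A := tail 0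
  have hs : X ^ 2 * sigma.toPowerSeries = X ^ 3 + (1 + X) * A := by
    change X ^ 2 * (X + (tail 2 + tail 1)) = _
    linear_combination X * h1 + h2
  rw [evalPoly_eq]
  -- The factor `X^2` makes the equation a polynomial in `X^2 σ`, hence in `A`, where `A^2 = A +
  -- X^4` applies.
  refine (mul_eq_zero.1 (?_ : X ^ 2 * _ = 0)).resolve_left (pow_ne_zero _ X_ne_zero)
  have : X ^ 2 * ((X * sigma.toPowerSeries) ^ 2 + X * sigma.toPowerSeries + sigma.toPowerSeries + X)
      = (X ^ 2 * sigma.toPowerSeries) ^ 2 + (1 + X) * (X ^ 2 * sigma.toPowerSeries) + X ^ 3 := by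
    ring
  rw [this, hs]
  linear_combination (1 + X) ^ 2 * h3 + (X ^ 6 + X ^ 3 * (1 + X) * A + X ^ 4 + X ^ 5 +
    (1 + X) ^ 2 * A + X ^ 3) * two_eq_zero_series

theorem hasSum_sigma :
    HasSum (fun k : {k : ℕ // 2 ≤ k} =>
      (X ^ (2 ^ k.1 - 2) + X ^ (2 ^ k.1 - 1) : PowerSeries (ZMod 2)))
      (sigma.toPowerSeries - X) := by
  change HasSum _ (X + (tail 2 + tail 1) - X)
  rw [add_sub_cancel_left]
  exact (hasSum_indicatorSeries (expo_injective (a := 2) (by norm_num))).add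
    (hasSum_indicatorSeries (expo_injective (a := 1) (by norm_num)))

theorem isUniqueSymmetricSolution : sigma.IsUniqueSymmetricSolution polyOne 1 :=
  ⟨isSymmetric, ⟨hasLeadingForm_of_evalPoly evalPoly_sigma, evalPoly_sigma⟩,
    fun _ _ h => eq_of_evalPoly h evalPoly_sigma⟩

/-- The support of `sigma`. -/
def support : Set ℕ := {n | (∃ k, n + 1 = 2 ^ (k + 1)) ∨ ∃ k, n + 2 = 2 ^ (k + 2)}

theorem sigma_eq_indicatorSeries : sigma.toPowerSeries = indicatorSeries support := by
  have hX : (X : PowerSeries (ZMod 2)) = indicatorSeries {1} := by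
    rw [indicatorSeries_singleton, pow_one]
  -- Parity separates the exponents `2^k - 2` from the exponents `2^k - 1`.
  have hpar : ∀ k : {k : ℕ // 2 ≤ k}, ∃ c, 2 ^ k.1 = 2 * c := fun k =>
    ⟨2 ^ (k.1 - 1), by rw [← pow_succ']; congr 1; have := k.2; omega⟩
  change X + (tail 2 + tail 1) = _
  rw [tail, tail, hX, ← indicatorSeries_union, ← indicatorSeries_union]
  · congr 1
    ext n
    simp only [support, Set.mem_union, Set.mem_singleton_iff, Set.mem_range, Set.mem_ofPred_eq]
    constructor
    · rintro (rfl | ⟨⟨k, hk⟩, rfl⟩ | ⟨⟨k, hk⟩, rfl⟩)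
      · exact Or.inl ⟨0, rfl⟩
      · have := four_le_two_pow ⟨k, hk⟩
        obtain ⟨l, rfl⟩ := Nat.exists_eq_add_of_le' hk
        exact Or.inr ⟨l, Nat.sub_add_cancel (by omega)⟩
      · have := four_le_two_pow ⟨k, hk⟩
        obtain ⟨l, rfl⟩ := Nat.exists_eq_add_of_le' hk
        exact Or.inl ⟨l + 1, Nat.sub_add_cancel (by omega)⟩
    · rintro (⟨k, hk⟩ | ⟨k, hk⟩)
      · rcases k with _ | k
        · left; simpa using hk
        · exact Or.inr (Or.inr ⟨⟨k + 2, by omega⟩, Nat.sub_eq_of_eq_add hk.symm⟩)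
      · exact Or.inr (Or.inl ⟨⟨k + 2, by omega⟩, Nat.sub_eq_of_eq_add hk.symm⟩)
  · rw [Set.disjoint_left]
    rintro _ rfl
    rintro (⟨k, hk⟩ | ⟨k, hk⟩) <;>
    · have := four_le_two_pow k
      simp only [expo] at hk; omega
  · rw [Set.disjoint_left]
    rintro _ ⟨k, rfl⟩ ⟨l, hl⟩
    have := four_le_two_pow k
    have := four_le_two_pow l
    obtain ⟨c, hc⟩ := hpar k
    obtain ⟨d, hd⟩ := hpar l
    simp only [expo] at hl
    omega

theorem isSparse_and_rank : IsSparse sigma.toPowerSeries ∧ sparsenessRank sigma.toPowerSeries = 1 := by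
  have h := isSparse_and_sparsenessRank_eq (f := sigma.toPowerSeries) (d := 1) (C := 2) (b := 2)
    (c := 1) ?_ le_rfl le_rfl ?_
  · simpa using h
  · intro N K hNK
    rw [sigma_eq_indicatorSeries, seriesSupport_indicatorSeries]
    have h := ncard_le_card_of_forall_exists (S := support ∩ Set.Iic N)
      (Finset.univ ×ˢ Finset.range (K + 1)) (fun x : Bool × ℕ => 2 ^ x.2 - cond x.1 1 2) ?_
    · simpa using h
    · rintro n ⟨⟨k, hk⟩ | ⟨k, hk⟩, hn⟩
      · refine ⟨(true, k + 1), ?_, by simp only [cond_true]; omega⟩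
        have : 2 ^ (k + 1) < 2 ^ (K + 1) := by
          simp only [Set.mem_Iic] at hn; rw [pow_succ 2 K]; omega
        have := (Nat.pow_lt_pow_iff_right (by norm_num)).1 this
        simpa using this
      · refine ⟨(false, k + 2), ?_, by simp only [cond_false]; omega⟩
        -- Here `2^(k+1) ≤ 2^(k+2) - 2 = n`, with equality for `k = 0`; this still gives `k + 2 ≤
        -- K`.
        have : 2 ^ (k + 1) < 2 ^ K := by
          simp only [Set.mem_Iic] at hn
          have h0 := Nat.one_le_two_pow (n := k)
          rw [pow_succ] at hk ⊢
          rw [pow_succ] at hk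
          omega
        have := (Nat.pow_lt_pow_iff_right (by norm_num)).1 this
        simp only [Finset.mem_product, Finset.mem_univ, Finset.mem_range, true_and]; omega
  · intro K
    rw [sigma_eq_indicatorSeries, seriesSupport_indicatorSeries]
    have h := card_le_ncard_of_injective (S := support ∩ Set.Iic (1 * 2 ^ K))
      ((Set.finite_Iic _).inter_of_right _) (Finset.range K) (f := fun k => 2 ^ (k + 1) - 1) ?_ ?_
    · simpa using h
    · intro k l h
      have h1 := Nat.one_le_two_pow (n := k + 1)
      have h2 := Nat.one_le_two_pow (n := l + 1)
      simp only at h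
      have := Nat.pow_right_injective le_rfl (show 2 ^ (k + 1) = 2 ^ (l + 1) by omega)
      omega
    · intro k hk
      have h1 := Nat.one_le_two_pow (n := k + 1)
      refine ⟨Or.inl ⟨k, by omega⟩, ?_⟩
      have : 2 ^ (k + 1) ≤ 2 ^ K := Nat.pow_le_pow_right (by norm_num) (Finset.mem_range.1 hk)
      simp only [Set.mem_Iic]; omega

/-- The coefficient read off by `automatonOne` from the digits of `n`, starting at the state `v`. -/
def read (v : StateOne) (n : ℕ) : ZMod 2 :=
  automatonOne.output (n.bits.foldl automatonOne.step v)

theorem read_bit (v : StateOne) (b : Bool) (n : ℕ) :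
    read v (Nat.bit b n) = read (automatonOne.step v b) n :=
  automatonOne.output_foldl_bits_bit v b n

theorem read_sink (n : ℕ) : read .sink n = 0 := by
  induction n using Nat.binaryRec with
  | zero => rfl
  | bit b n ih => rw [read_bit]; cases b <;> exact ih

theorem read_done (n : ℕ) : read .done n = 1 ↔ n = 0 := by
  induction n using Nat.binaryRec with
  | zero => exact iff_of_true rfl rfl
  | bit b n ih =>
    rw [read_bit]
    cases b
    · refine Iff.trans ih ?_
      simp [Nat.bit]
    · change read .sink n = 1 ↔ _
      simp [read_sink, Nat.bit]

/-- A digit 1 replaces `n` by `2n + 1`, which doubles `n + 1`; a digit 0 forces all higher digits to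
vanish. -/
theorem read_ones (n : ℕ) : read .ones n = 1 ↔ ∃ k, n + 1 = 2 ^ k := by
  induction n using Nat.binaryRec with
  | zero => exact iff_of_true rfl ⟨0, rfl⟩
  | bit b n ih =>
    rw [read_bit]
    cases b
    · change read .done n = 1 ↔ ∃ k, 2 * n + 1 = 2 ^ k
      rw [read_done]
      constructor
      · rintro rfl; exact ⟨0, rfl⟩
      · rintro ⟨_ | k, hk⟩
        · simpa using hk
        · rw [pow_succ] at hk; omega
    · change read .ones n = 1 ↔ ∃ k, 2 * n + 1 + 1 = 2 ^ k
      rw [ih]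
      constructor
      · rintro ⟨k, hk⟩; exact ⟨k + 1, by rw [pow_succ]; omega⟩
      · rintro ⟨_ | k, hk⟩
        · simp at hk
        · exact ⟨k, by rw [pow_succ] at hk; omega⟩

theorem read_zero (n : ℕ) : read .zero n = 1 ↔ ∃ k, n + 1 = 2 ^ (k + 1) := by
  rw [← Nat.bit_bodd_div2 n, read_bit]
  generalize n.div2 = n
  cases Nat.bodd _
  · change read .sink n = 1 ↔ ∃ k, 2 * n + 1 = 2 ^ (k + 1)
    rw [read_sink]
    refine iff_of_false (by decide) ?_
    rintro ⟨k, hk⟩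
    rw [pow_succ] at hk; omega
  · change read .ones n = 1 ↔ ∃ k, 2 * n + 1 + 1 = 2 ^ (k + 1)
    rw [read_ones]
    exact exists_congr fun k => by rw [pow_succ]; omega

theorem read_start (n : ℕ) : read .start n = 1 ↔ n ∈ support := by
  change _ ↔ (∃ k, n + 1 = 2 ^ (k + 1)) ∨ ∃ k, n + 2 = 2 ^ (k + 2)
  rw [← Nat.bit_bodd_div2 n, read_bit]
  generalize n.div2 = n
  cases Nat.bodd _
  · change read .zero n = 1 ↔ (∃ k, 2 * n + 1 = 2 ^ (k + 1)) ∨ ∃ k, 2 * n + 2 = 2 ^ (k + 2)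
    rw [read_zero, or_iff_right]
    · exact exists_congr fun k => by rw [pow_succ 2 (k + 1)]; omega
    · rintro ⟨k, hk⟩
      rw [pow_succ] at hk; omega
  · change read .ones n = 1 ↔
      (∃ k, 2 * n + 1 + 1 = 2 ^ (k + 1)) ∨ ∃ k, 2 * n + 1 + 2 = 2 ^ (k + 2)
    rw [read_ones, or_iff_left]
    · exact exists_congr fun k => by rw [pow_succ]; omega
    · rintro ⟨k, hk⟩
      rw [pow_succ] at hk; omega

theorem automatonOne_series : automatonOne.series = sigma.toPowerSeries := by
  rw [sigma_eq_indicatorSeries]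
  exact TwoAutomaton.series_eq_indicatorSeries read_start

end CaseOne

/-! ### Binary words -/

theorem binaryWord_one : binaryWord 1 = [true] := by simp [binaryWord]

theorem binaryWord_two_mul {n : ℕ} (hn : n ≠ 0) :
    binaryWord (2 * n) = binaryWord n ++ [false] := by
  rw [binaryWord, Nat.bit0_bits n hn, List.reverse_cons]; rfl

theorem binaryWord_two_mul_add_one (n : ℕ) :
    binaryWord (2 * n + 1) = binaryWord n ++ [true] := by
  rw [binaryWord, Nat.bit1_bits n, List.reverse_cons]; rfl

theorem binaryWord_two_pow_mul (a : ℕ) {n : ℕ} (hn : n ≠ 0) :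
    binaryWord (2 ^ a * n) = binaryWord n ++ List.replicate a false := by
  induction a with
  | zero => simp
  | succ a ih =>
    rw [pow_succ', mul_assoc, binaryWord_two_mul (by positivity), ih, List.append_assoc,
      ← List.replicate_succ']

theorem binaryWord_injective : Function.Injective binaryWord := by
  intro a b h
  have h' : a.bits = b.bits := List.reverse_injective h
  rw [← Nat.ofDigits_digits 2 a, ← Nat.ofDigits_digits 2 b, Nat.digits_two_eq_bits,
    Nat.digits_two_eq_bits, h']

/-! ### The case `m = 2^μ - 1 > 1` -/

namespace CaseMinus

open PowerSeries

theorem isSymmetric (μ : ℕ) : (polyMinus μ).IsSymmetric := by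
  apply isSymmetric_of_rename_swap
  simp [polyMinus]
  ring

theorem evalPoly_eq (μ : ℕ) (σ : Nottingham (ZMod 2)) : Nottingham.evalPoly (polyMinus μ) σ =
    (X * σ.toPowerSeries) ^ 2 ^ (μ - 1) + σ.toPowerSeries + X := by
  simp [Nottingham.evalPoly, polyMinus]

/-- With `q = 2^(μ-1)` and `δ = σ - τ`, Frobenius turns the difference of the equations into `X^q
δ^q + δ = 0`, and `1 + X^q δ^(q-1)` is nonzero. -/
theorem eq_of_evalPoly {μ : ℕ} {σ τ : Nottingham (ZMod 2)}
    (hσ : Nottingham.evalPoly (polyMinus μ) σ = 0)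
    (hτ : Nottingham.evalPoly (polyMinus μ) τ = 0) : σ = τ := by
  rw [evalPoly_eq] at hσ hτ
  have hq : 2 ^ (μ - 1) ≠ 0 := by positivity
  have h1 := sub_pow_char_pow (X * σ.toPowerSeries) (X * τ.toPowerSeries) (p := 2) (n := μ - 1)
  rw [← mul_sub, mul_pow] at h1
  have h : (σ.toPowerSeries - τ.toPowerSeries) *
      (1 + X ^ 2 ^ (μ - 1) * (σ.toPowerSeries - τ.toPowerSeries) ^ (2 ^ (μ - 1) - 1)) = 0 := by
    have h2 := mul_pow_sub_one hq (σ.toPowerSeries - τ.toPowerSeries)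
    linear_combination hσ - hτ + h1 + X ^ 2 ^ (μ - 1) * h2
  exact Nottingham.ext (sub_eq_zero.1 ((mul_eq_zero.1 h).resolve_right
    (Nottingham.ne_zero_of_constantCoeff (by simp))))

theorem two_mul_two_pow {μ : ℕ} (hμ : 2 ≤ μ) : 2 * 2 ^ (μ - 1) = 2 ^ μ :=
  mul_pow_sub_one (by omega) 2

theorem hasLeadingForm_of_evalPoly {μ m : ℕ} (hμ : 2 ≤ μ) (hm : m = 2 ^ μ - 1)
    {σ : Nottingham (ZMod 2)} (hσ : Nottingham.evalPoly (polyMinus μ) σ = 0) :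
    σ.HasLeadingForm m := by
  rw [evalPoly_eq] at hσ
  obtain ⟨v, hv, hσv⟩ := σ.exists_eq_X_mul
  refine Nottingham.hasLeadingForm_iff_exists.2 ⟨v ^ 2 ^ (μ - 1), by simp [hv], ?_⟩
  have h1 : m + 1 = 2 ^ (μ - 1) + 2 ^ (μ - 1) := by
    have := two_mul_two_pow hμ
    have := Nat.one_le_two_pow (n := μ)
    omega
  have h2 : (X * σ.toPowerSeries) ^ 2 ^ (μ - 1) =
      X ^ (2 ^ (μ - 1) + 2 ^ (μ - 1)) * v ^ 2 ^ (μ - 1) := by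
    rw [hσv, ← mul_assoc, mul_pow, mul_pow, pow_add]
  rw [h1]
  linear_combination hσ - h2 - (X + X ^ (2 ^ (μ - 1) + 2 ^ (μ - 1)) * v ^ 2 ^ (μ - 1)) *
    two_eq_zero_series

/-- Half the `l`-th exponent of `σ - t`. -/
def half (μ : ℕ) : ℕ → ℕ
  | 0 => 2 ^ (μ - 1)
  | l + 1 => 2 ^ (μ - 2) * (2 * half μ l + 1)

/-- The `l`-th exponent of `σ - t`. -/
def expo (μ l : ℕ) : ℕ := 2 * half μ l

theorem two_mul_two_pow_sub_two {μ : ℕ} (hμ : 2 ≤ μ) : 2 * 2 ^ (μ - 2) = 2 ^ (μ - 1) :=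
  mul_pow_sub_one (by omega : μ - 1 ≠ 0) 2

theorem expo_zero (μ : ℕ) : expo μ 0 = 2 * 2 ^ (μ - 1) := rfl

theorem expo_succ {μ : ℕ} (hμ : 2 ≤ μ) (l : ℕ) :
    expo μ (l + 1) = 2 ^ (μ - 1) * (expo μ l + 1) := by
  rw [← two_mul_two_pow_sub_two hμ, mul_assoc]; rfl

theorem two_le_two_pow {μ : ℕ} (hμ : 2 ≤ μ) : 2 ≤ 2 ^ (μ - 1) := by
  have := Nat.pow_le_pow_right (n := 2) (by norm_num) (show 1 ≤ μ - 1 by omega)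
  simpa using this

theorem two_pow_lt_expo {μ : ℕ} (hμ : 2 ≤ μ) (l : ℕ) : 2 ^ (l + 1) < expo μ l := by
  have hq := two_le_two_pow hμ
  induction l with
  | zero => rw [expo_zero]; omega
  | succ l ih =>
    rw [expo_succ hμ, pow_succ]
    nlinarith

theorem expo_strictMono {μ : ℕ} (hμ : 2 ≤ μ) : StrictMono (expo μ) := by
  refine strictMono_nat_of_lt_succ fun l => ?_
  have hq := two_le_two_pow hμ
  rw [expo_succ hμ]
  nlinarith

theorem expo_lt {μ : ℕ} (hμ : 2 ≤ μ) (l : ℕ) : expo μ l < (2 * 2 ^ (μ - 1) + 1) ^ (l + 1) := by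
  have hq := two_le_two_pow hμ
  induction l with
  | zero => rw [expo_zero, zero_add, pow_one]; omega
  | succ l ih =>
    rw [expo_succ hμ, pow_succ]
    nlinarith

/-- The closed form solves the affine recursion `e ↦ q(e + 1)`, `q = 2^(μ-1)`, from `e = 2q`.
Working over `ℚ` avoids the truncated operations. -/
theorem minusExponent_eq_expo {μ m : ℕ} (hμ : 2 ≤ μ) (hm : m = 2 ^ μ - 1) (l : ℕ) :
    minusExponent m (l + 1) = expo μ l := by
  have hq := two_le_two_pow hμ
  have h2 := two_mul_two_pow hμ
  have he : ∀ l, ((2 : ℚ) ^ (μ - 1) - 1) * expo μ l =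
      2 ^ (μ - 1) * ((2 * 2 ^ (μ - 1) - 1) * (2 ^ (μ - 1)) ^ l - 1) := by
    intro l
    induction l with
    | zero => rw [expo_zero]; push_cast; ring
    | succ l ih =>
      rw [expo_succ hμ, pow_succ]
      push_cast
      linear_combination (2 : ℚ) ^ (μ - 1) * ih
  have hq' : (2 : ℚ) ≤ 2 ^ (μ - 1) := by exact_mod_cast hq
  have hmq : (m : ℚ) = 2 * 2 ^ (μ - 1) - 1 := by
    have : m + 1 = 2 * 2 ^ (μ - 1) := by omega
    have h : (m : ℚ) + 1 = 2 * 2 ^ (μ - 1) := by exact_mod_cast this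
    linarith
  have hc := minusExponent_cast m (l + 1) (by omega) (by
    rw [Nat.odd_iff]; omega)
  have : (minusExponent m (l + 1) : ℚ) = expo μ l := by
    rw [hc, hmq, Nat.add_sub_cancel]
    have h3 : (2 : ℚ) ^ (μ - 1) - 1 ≠ 0 := by linarith
    have h4 : (2 * (2 : ℚ) ^ (μ - 1) - 1 - 1) ≠ 0 := by linarith
    have h5 : (2 * (2 : ℚ) ^ (μ - 1) - 1 + 1) / 2 = 2 ^ (μ - 1) := by ring
    rw [h5, div_mul_eq_mul_div, div_eq_iff h4]
    linear_combination -2 * he l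
  exact_mod_cast this

/-- The series `σ - t`. -/
noncomputable def tail (μ : ℕ) : PowerSeries (ZMod 2) := indicatorSeries (Set.range (expo μ))

/-- This is the recursion `e ↦ q + q e` on exponents, with `2q` the initial one; it is equivalent to
`F(t, t + tail) = 0`. -/
theorem tail_eq {μ : ℕ} (hμ : 2 ≤ μ) :
    tail μ = X ^ (2 * 2 ^ (μ - 1)) + X ^ 2 ^ (μ - 1) * tail μ ^ 2 ^ (μ - 1) := by
  have hinj := (expo_strictMono hμ).injective
  have hpos : 2 ^ (μ - 1) ≠ 0 := by positivity
  have hu : {2 * 2 ^ (μ - 1)} ∪ (Set.range fun l => 2 ^ (μ - 1) + 2 ^ (μ - 1) * expo μ l) =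
      Set.range (expo μ) := by
    ext n
    constructor
    · rintro (rfl | ⟨l, rfl⟩)
      · exact ⟨0, rfl⟩
      · exact ⟨l + 1, by rw [expo_succ hμ]; ring⟩
    · rintro ⟨_ | l, rfl⟩
      · exact Or.inl rfl
      · exact Or.inr ⟨l, by rw [expo_succ hμ]; ring⟩
  have hd : Disjoint {2 * 2 ^ (μ - 1)}
      (Set.range fun l => 2 ^ (μ - 1) + 2 ^ (μ - 1) * expo μ l) := by
    rw [Set.disjoint_singleton_left]
    rintro ⟨l, hl⟩
    have h1 := (expo_strictMono hμ) (Nat.succ_pos l)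
    rw [expo_zero, Nat.succ_eq_add_one, expo_succ hμ] at h1
    linarith
  rw [tail, indicatorSeries_range_pow_two_pow hinj, X_pow_mul_indicatorSeries_range,
    ← indicatorSeries_singleton, ← indicatorSeries_union hd, hu]
  exact fun a b h => hinj (Nat.eq_of_mul_eq_mul_left (Nat.pos_of_ne_zero hpos) h)

theorem coeff_tail_of_lt {μ : ℕ} (hμ : 2 ≤ μ) {n : ℕ} (hn : n < 2) : coeff n (tail μ) = 0 := by
  rw [tail, coeff_indicatorSeries, if_neg]
  rintro ⟨l, rfl⟩
  have := two_pow_lt_expo hμ l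
  rw [pow_succ] at this
  have := Nat.one_le_two_pow (n := l)
  omega

/-- The series `t + ∑ t ^ e`, over the exponents `e = minusExponent m k`, `k ≥ 1`. -/
noncomputable def sigma {μ : ℕ} (hμ : 2 ≤ μ) : Nottingham (ZMod 2) where
  toPowerSeries := X + tail μ
  constantCoeff_eq := by
    rw [map_add, constantCoeff_X, ← coeff_zero_eq_constantCoeff_apply,
      coeff_tail_of_lt hμ (by norm_num), add_zero]
  coeff_one_eq := by
    rw [map_add, coeff_one_X, coeff_tail_of_lt hμ (by norm_num), add_zero]

theorem evalPoly_sigma {μ : ℕ} (hμ : 2 ≤ μ) :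
    Nottingham.evalPoly (polyMinus μ) (sigma hμ) = 0 := by
  rw [evalPoly_eq]
  change (X * (X + tail μ)) ^ 2 ^ (μ - 1) + (X + tail μ) + X = 0
  rw [mul_pow, add_pow_char_pow (p := 2)]
  have h := tail_eq hμ
  rw [two_mul, pow_add] at h
  linear_combination -h + (X + tail μ) * two_eq_zero_series

theorem hasSum_sigma {μ m : ℕ} (hμ : 2 ≤ μ) (hm : m = 2 ^ μ - 1) :
    HasSum (fun k : {k : ℕ // 1 ≤ k} => (X ^ minusExponent m k.1 : PowerSeries (ZMod 2)))
      ((sigma hμ).toPowerSeries - X) := by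
  have he : ∀ k : {k : ℕ // 1 ≤ k}, minusExponent m k.1 = expo μ (k.1 - 1) := fun k => by
    rw [← minusExponent_eq_expo hμ hm, Nat.sub_add_cancel k.2]
  have hr : Set.range (expo μ) = Set.range fun k : {k : ℕ // 1 ≤ k} => minusExponent m k.1 := by
    ext n
    constructor
    · rintro ⟨l, rfl⟩
      exact ⟨⟨l + 1, by omega⟩, minusExponent_eq_expo hμ hm l⟩
    · rintro ⟨k, rfl⟩
      exact ⟨k.1 - 1, (he k).symm⟩
  change HasSum _ (X + tail μ - X)
  rw [add_sub_cancel_left, tail, hr]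
  refine hasSum_indicatorSeries fun k l h => Subtype.ext ?_
  simp only [he] at h
  have := (expo_strictMono hμ).injective h
  have := k.2
  have := l.2
  omega

theorem isUniqueSymmetricSolution {μ m : ℕ} (hμ : 2 ≤ μ) (hm : m = 2 ^ μ - 1) :
    (sigma hμ).IsUniqueSymmetricSolution (polyMinus μ) m :=
  ⟨isSymmetric μ, ⟨hasLeadingForm_of_evalPoly hμ hm (evalPoly_sigma hμ), evalPoly_sigma hμ⟩,
    fun _ _ h => eq_of_evalPoly h (evalPoly_sigma hμ)⟩

theorem odd_exponent {μ m : ℕ} (hμ : 2 ≤ μ) (hm : m = 2 ^ μ - 1) : Odd m := by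
  have := two_mul_two_pow hμ
  have := two_le_two_pow hμ
  rw [Nat.odd_iff]; omega

theorem sigma_eq_indicatorSeries {μ : ℕ} (hμ : 2 ≤ μ) :
    (sigma hμ).toPowerSeries = indicatorSeries ({1} ∪ Set.range (expo μ)) := by
  rw [indicatorSeries_union, indicatorSeries_singleton, pow_one]
  · rfl
  · rw [Set.disjoint_singleton_left]
    rintro ⟨l, hl⟩
    rw [expo] at hl; omega

theorem half_ne_zero (μ l : ℕ) : half μ l ≠ 0 := by
  cases l <;> simp [half]

/-- One step of the recursion appends a digit 1 (passing to `2h + 1`) and then `μ - 2` zeros.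
Halving the exponents removes the final 0 that would otherwise separate the blocks from the
recursion. -/
theorem binaryWord_half (μ l : ℕ) : binaryWord (half μ l) =
    true :: List.replicate (μ - 1) false ++
      (List.replicate l (true :: List.replicate (μ - 2) false)).flatten := by
  induction l with
  | zero =>
    rw [half, ← mul_one (2 ^ (μ - 1)), binaryWord_two_pow_mul _ one_ne_zero, binaryWord_one]
    simp
  | succ l ih =>
    rw [half, binaryWord_two_pow_mul _ (by omega), binaryWord_two_mul_add_one, ih,
      List.replicate_succ', List.flatten_append]
    simp

theorem binaryWord_expo (μ l : ℕ) : binaryWord (expo μ l) = supportWord μ l := by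
  rw [expo, binaryWord_two_mul (half_ne_zero μ l), binaryWord_half]; rfl

theorem seriesSupport_sigma {μ : ℕ} (hμ : 2 ≤ μ) :
    seriesSupport (sigma hμ).toPowerSeries =
      {n : ℕ | binaryWord n = [true] ∨ ∃ l : ℕ, binaryWord n = supportWord μ l} := by
  rw [sigma_eq_indicatorSeries, seriesSupport_indicatorSeries]
  ext n
  refine or_congr ?_ (exists_congr fun l => ?_)
  · rw [← binaryWord_one, binaryWord_injective.eq_iff]; rfl
  · rw [← binaryWord_expo, binaryWord_injective.eq_iff, eq_comm]

theorem isSparse_and_rank {μ : ℕ} (hμ : 2 ≤ μ) :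
    IsSparse (sigma hμ).toPowerSeries ∧ sparsenessRank (sigma hμ).toPowerSeries = 1 := by
  have h := isSparse_and_sparsenessRank_eq (f := (sigma hμ).toPowerSeries) (d := 1) (C := 1)
    (b := 2 * 2 ^ (μ - 1) + 1) (c := 1) ?_ (by have := two_le_two_pow hμ; omega) le_rfl ?_
  · simpa using h
  · intro N K hNK
    rw [sigma_eq_indicatorSeries, seriesSupport_indicatorSeries]
    have h := ncard_le_card_of_forall_exists (S := ({1} ∪ Set.range (expo μ)) ∩ Set.Iic N)
      -- Index 0 is reserved for the exponent 1 of the term `t`.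
      (Finset.range (K + 1)) (fun k => if k = 0 then 1 else expo μ (k - 1)) ?_
    · simpa using h
    · rintro n ⟨rfl | ⟨l, rfl⟩, hn⟩
      · exact ⟨0, by simp, rfl⟩
      · have h1 : 2 ^ (l + 1) < 2 ^ K := (two_pow_lt_expo hμ l).trans (lt_of_le_of_lt hn hNK)
        have := (Nat.pow_lt_pow_iff_right (by norm_num)).1 h1
        exact ⟨l + 1, Finset.mem_range.2 (by omega), by simp⟩
  · intro K
    rw [sigma_eq_indicatorSeries, seriesSupport_indicatorSeries]
    have h := card_le_ncard_of_injective
      (S := ({1} ∪ Set.range (expo μ)) ∩ Set.Iic (1 * (2 * 2 ^ (μ - 1) + 1) ^ K))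
      ((Set.finite_Iic _).inter_of_right _) (Finset.range K) (expo_strictMono hμ).injective ?_
    · simpa using h
    · intro l hl
      refine ⟨Or.inr ⟨l, rfl⟩, ?_⟩
      rw [one_mul]
      exact (expo_lt hμ l).le.trans
        (Nat.pow_le_pow_right (by omega) (Finset.mem_range.1 hl))

/-! ### The automaton for `m = 2^μ - 1` -/

section Automaton

variable {μ : ℕ} (hμ : 2 ≤ μ)

/-- The coefficient read off by `automatonMinus` from the digits of `n`, starting at the state
`v`. -/
def read (v : StateMinus μ) (n : ℕ) : ZMod 2 :=
  (automatonMinus μ hμ).output (n.bits.foldl (automatonMinus μ hμ).step v)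

theorem read_bit (v : StateMinus μ) (b : Bool) (n : ℕ) :
    read hμ v (Nat.bit b n) = read hμ (stepMinus μ hμ v b) n :=
  (automatonMinus μ hμ).output_foldl_bits_bit v b n

theorem read_sink (n : ℕ) : read hμ .sink n = 0 := by
  induction n using Nat.binaryRec with
  | zero => rfl
  | bit b n ih => rw [read_bit]; exact ih

theorem read_done (n : ℕ) : read hμ .done n = 1 ↔ n = 0 := by
  induction n using Nat.binaryRec with
  | zero => exact iff_of_true rfl rfl
  | bit b n ih =>
    rw [read_bit]
    cases b
    · refine Iff.trans ih ?_
      simp [Nat.bit]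
    · change read hμ .sink n = 1 ↔ _
      simp [read_sink, Nat.bit]

theorem read_last (n : ℕ) : read hμ .last n = 1 ↔ n = 1 := by
  rw [← Nat.bit_bodd_div2 n, read_bit]
  generalize n.div2 = n
  cases Nat.bodd _
  · change read hμ .sink n = 1 ↔ 2 * n = 1
    rw [read_sink]
    exact iff_of_false (by decide) (by omega)
  · change read hμ .done n = 1 ↔ 2 * n + 1 = 1
    rw [read_done]; omega

/-- Here `r` is the distance to the final state of the path; a digit 1 before that state leads to
the sink, so the next `r` digits must be 0. -/
theorem read_path (r : ℕ) : ∀ (i : ℕ) (hi : i < μ - 1), i + r = μ - 2 → ∀ n : ℕ,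
    (read hμ (.path ⟨i, hi⟩) n = 1 ↔
      ∃ k, n = 2 ^ r * k ∧ read hμ (.path ⟨μ - 2, by omega⟩) k = 1) := by
  induction r with
  | zero =>
    intro i hi hir n
    obtain rfl : i = μ - 2 := by omega
    simp
  | succ r ih =>
    intro i hi hir n
    rw [← Nat.bit_bodd_div2 n, read_bit]
    generalize n.div2 = n
    cases Nat.bodd _
    · have h1 : stepMinus μ hμ (.path ⟨i, hi⟩) false = .path ⟨i + 1, by omega⟩ :=
        dif_pos (by simp only; omega)
      rw [h1, ih (i + 1) (by omega) (by omega)]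
      refine exists_congr fun k => and_congr_left fun _ => ?_
      change _ ↔ 2 * n = _
      rw [pow_succ', mul_assoc]; omega
    · have h1 : stepMinus μ hμ (.path ⟨i, hi⟩) true = .sink :=
        if_neg (by simp only; omega)
      rw [h1, read_sink]
      refine iff_of_false (by decide) ?_
      rintro ⟨k, hk, -⟩
      change 2 * n + 1 = _ at hk
      rw [pow_succ', mul_assoc] at hk; omega

theorem read_path_final (n : ℕ) : read hμ (.path ⟨μ - 2, by omega⟩) n = 1 ↔
    n = 2 ∨ ∃ k, n = 2 * k + 1 ∧ read hμ (.path ⟨0, by omega⟩) k = 1 := by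
  rw [← Nat.bit_bodd_div2 n, read_bit]
  generalize n.div2 = n
  cases Nat.bodd _
  · have h1 : stepMinus μ hμ (.path ⟨μ - 2, by omega⟩) false = .last :=
      dif_neg (by simp only; omega)
    rw [h1, read_last]
    change _ ↔ 2 * n = 2 ∨ ∃ k, 2 * n = 2 * k + 1 ∧ _
    constructor
    · rintro rfl; exact Or.inl rfl
    · rintro (h | ⟨k, hk, -⟩) <;> omega
  · have h1 : stepMinus μ hμ (.path ⟨μ - 2, by omega⟩) true = .path ⟨0, by omega⟩ :=
      if_pos (by simp only; omega)
    rw [h1]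
    change _ ↔ 2 * n + 1 = 2 ∨ ∃ k, 2 * n + 1 = 2 * k + 1 ∧ _
    constructor
    · exact fun h => Or.inr ⟨n, rfl, h⟩
    · rintro (h | ⟨k, hk, h⟩)
      · omega
      · obtain rfl : n = k := by omega
        exact h

/-- One trip around the loop strips `μ - 2` zeros and a 1, which inverts the recursion for `half`;
leaving the loop corresponds to `2^(μ-2) * 2`, the value at `l = 0`. -/
theorem read_path_zero (n : ℕ) :
    read hμ (.path ⟨0, by omega⟩) n = 1 ↔ ∃ l, half μ l = n := by
  induction n using Nat.strong_induction_on with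
  | _ n ih =>
    rw [read_path hμ (μ - 2) 0 (by omega) (by omega)]
    simp only [read_path_final]
    constructor
    · rintro ⟨k, rfl, rfl | ⟨k, rfl, hk⟩⟩
      · exact ⟨0, by rw [half, ← two_mul_two_pow_sub_two hμ, mul_comm]⟩
      · have hlt : k < 2 ^ (μ - 2) * (2 * k + 1) := by
          have := Nat.one_le_two_pow (n := μ - 2)
          nlinarith
        obtain ⟨l, rfl⟩ := (ih k hlt).1 hk
        exact ⟨l + 1, rfl⟩
    · rintro ⟨_ | l, rfl⟩
      · exact ⟨2, by rw [half, ← two_mul_two_pow_sub_two hμ, mul_comm], Or.inl rfl⟩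
      · refine ⟨2 * half μ l + 1, rfl, Or.inr ⟨half μ l, rfl, (ih _ ?_).2 ⟨l, rfl⟩⟩⟩
        rw [half]
        have := Nat.one_le_two_pow (n := μ - 2)
        nlinarith

theorem read_start (n : ℕ) : read hμ .start n = 1 ↔ n ∈ {1} ∪ Set.range (expo μ) := by
  change _ ↔ n = 1 ∨ ∃ l, 2 * half μ l = n
  rw [← Nat.bit_bodd_div2 n, read_bit]
  generalize n.div2 = n
  cases Nat.bodd _
  · change read hμ (.path ⟨0, by omega⟩) n = 1 ↔ 2 * n = 1 ∨ ∃ l, 2 * half μ l = 2 * n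
    rw [read_path_zero, or_iff_right (by omega)]
    exact exists_congr fun l => by omega
  · change read hμ .done n = 1 ↔ 2 * n + 1 = 1 ∨ ∃ l, 2 * half μ l = 2 * n + 1
    rw [read_done, or_iff_left]
    · omega
    · rintro ⟨l, hl⟩; omega

theorem automatonMinus_series : (automatonMinus μ hμ).series = (sigma hμ).toPowerSeries := by
  rw [sigma_eq_indicatorSeries]
  exact TwoAutomaton.series_eq_indicatorSeries (read_start hμ)

end Automaton

end CaseMinus

/-! ### Numbers with digit positions distinct modulo `μ` -/

/-- The number with binary digits `1` at the positions in `s`. -/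
def ofPositions (s : Finset ℕ) : ℕ := ∑ i ∈ s, 2 ^ i

theorem ofPositions_injective : Function.Injective ofPositions :=
  Finset.equivBitIndices.symm.injective

theorem onePositions_ofPositions (s : Finset ℕ) : onePositions (ofPositions s) = s := by
  ext i
  have h := Finset.toFinset_bitIndices_sum_two_pow s
  rw [Finset.mem_coe, ← Finset.ext_iff.1 h i, List.mem_toFinset, Nat.mem_bitIndices]
  rfl

theorem ofPositions_surjective : Function.Surjective ofPositions :=
  Finset.equivBitIndices.symm.surjective

theorem ofPositions_union {s t : Finset ℕ} (h : Disjoint s t) :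
    ofPositions (s ∪ t) = ofPositions s + ofPositions t := Finset.sum_union h

/-- The multiples by `m` of the numbers whose digits `1` lie at positions that are distinct modulo
`μ` with residues in `R`. -/
def residueSet (μ m : ℕ) (R : Set ℕ) : Set ℕ :=
  {n | ∃ s : Finset ℕ, Set.InjOn (fun i => i % μ) (s : Set ℕ) ∧ (∀ i ∈ s, i % μ ∈ R) ∧
    m * ofPositions s = n}

open scoped Pointwise in
-- Disjoint residue classes give disjoint position sets, so addition has no carries. Filtering the
-- union by residue recovers both summands, which is the uniqueness needed for
-- `indicatorSeries_mul`.
theorem indicatorSeries_residueSet_mul {μ m : ℕ} (hm : m ≠ 0) {R R' : Set ℕ}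
    (hR : Disjoint R R') :
    indicatorSeries (residueSet μ m R) * indicatorSeries (residueSet μ m R') =
      indicatorSeries (residueSet μ m (R ∪ R')) := by
  classical
  have hdisj : ∀ s s' : Finset ℕ, (∀ i ∈ s, i % μ ∈ R) → (∀ i ∈ s', i % μ ∈ R') →
      Disjoint s s' := fun s s' h h' => Finset.disjoint_left.2 fun i hi hi' =>
    Set.disjoint_left.1 hR (h i hi) (h' i hi')
  have hfilter : ∀ s s' : Finset ℕ, (∀ i ∈ s, i % μ ∈ R) → (∀ i ∈ s', i % μ ∈ R') →
      (s ∪ s').filter (fun i => i % μ ∈ R) = s := by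
    intro s s' h h'
    ext i
    simp only [Finset.mem_filter, Finset.mem_union]
    constructor
    · rintro ⟨hi | hi, hiR⟩
      · exact hi
      · exact absurd (h' i hi) (Set.disjoint_left.1 hR hiR)
    · exact fun hi => ⟨Or.inl hi, h i hi⟩
  rw [indicatorSeries_mul]
  · congr 1
    ext n
    constructor
    · rintro ⟨_, ⟨s, hs, hsR, rfl⟩, _, ⟨s', hs', hsR', rfl⟩, rfl⟩
      refine ⟨s ∪ s', ?_, ?_, ?_⟩
      · rw [Finset.coe_union, Set.injOn_union (by exact_mod_cast hdisj s s' hsR hsR')]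
        exact ⟨hs, hs', fun i hi j hj h =>
          Set.disjoint_left.1 hR (hsR i hi) (by rw [show i % μ = j % μ from h]; exact hsR' j hj)⟩
      · intro i hi
        rcases Finset.mem_union.1 hi with hi | hi
        · exact Or.inl (hsR i hi)
        · exact Or.inr (hsR' i hi)
      · simp only [ofPositions_union (hdisj s s' hsR hsR'), mul_add]
    · rintro ⟨s, hs, hsR, rfl⟩
      refine ⟨_, ⟨s.filter (fun i => i % μ ∈ R), hs.mono (Finset.filter_subset _ _), ?_, rfl⟩, _,
        ⟨s.filter (fun i => i % μ ∉ R), hs.mono (Finset.filter_subset _ _), ?_, rfl⟩, ?_⟩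
      · exact fun i hi => (Finset.mem_filter.1 hi).2
      · intro i hi
        obtain ⟨h1, h2⟩ := Finset.mem_filter.1 hi
        exact (hsR i h1).resolve_left h2
      · simp only
        rw [← mul_add, ← ofPositions_union (Finset.disjoint_filter_filter_not _ _ _),
          Finset.filter_union_filter_not_eq]
  · rintro _ ⟨s, hs, hsR, rfl⟩ _ ⟨s', hs', hsR', rfl⟩ _ ⟨t, ht, htR, rfl⟩ _ ⟨t', ht', htR', rfl⟩ h
    rw [← mul_add, ← mul_add, ← ofPositions_union (hdisj _ _ hsR hsR'),
      ← ofPositions_union (hdisj _ _ htR htR')] at h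
    have h' := ofPositions_injective (Nat.eq_of_mul_eq_mul_left (Nat.pos_of_ne_zero hm) h)
    rw [← hfilter s s' hsR hsR', h', hfilter t t' htR htR']

theorem residueSet_empty (μ m : ℕ) : residueSet μ m ∅ = {0} := by
  ext n
  constructor
  · rintro ⟨s, -, hs, rfl⟩
    have : s = ∅ := Finset.eq_empty_of_forall_notMem fun i hi => hs i hi
    simp [this, ofPositions]
  · rintro rfl
    exact ⟨∅, by simp, by simp, by simp [ofPositions]⟩

/-- With a single residue allowed, the position set is empty or `{j + μ k}`. -/
theorem residueSet_singleton {μ : ℕ} (m : ℕ) {j : ℕ} (hj : j < μ) :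
    residueSet μ m {j} = {0} ∪ Set.range fun k => 2 ^ j * (m * (2 ^ μ) ^ k) := by
  ext n
  constructor
  · rintro ⟨s, hs, hsR, rfl⟩
    rcases s.eq_empty_or_nonempty with rfl | ⟨i, hi⟩
    · left; simp [ofPositions]
    · have : s = {i} := Finset.eq_singleton_iff_unique_mem.2
        ⟨hi, fun i' hi' => hs hi' hi ((hsR i' hi').trans (hsR i hi).symm)⟩
      subst this
      have h : i % μ = j := hsR i hi
      refine Or.inr ⟨i / μ, ?_⟩
      simp only [ofPositions, Finset.sum_singleton]
      nth_rw 2 [← Nat.mod_add_div i μ]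
      rw [h, pow_add, pow_mul]; ring
  · rintro (rfl | ⟨k, rfl⟩)
    · exact ⟨∅, by simp, by simp, by simp [ofPositions]⟩
    · refine ⟨{j + μ * k}, by simp, ?_, ?_⟩
      · simp [Nat.mod_eq_of_lt hj]
      · simp only [ofPositions, Finset.sum_singleton]
        rw [pow_add, pow_mul]; ring

theorem prod_indicatorSeries_residueSet {μ m : ℕ} (hm : m ≠ 0) (r : ℕ) :
    ∏ j ∈ Finset.range r, indicatorSeries (residueSet μ m {j}) =
      indicatorSeries (residueSet μ m (Set.Iio r)) := by
  induction r with
  | zero =>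
    rw [Finset.prod_range_zero, show Set.Iio 0 = (∅ : Set ℕ) by ext; simp, residueSet_empty,
      indicatorSeries_singleton, pow_zero]
  | succ r ih =>
    rw [Finset.prod_range_succ, ih, indicatorSeries_residueSet_mul hm (by simp)]
    congr 2
    ext i; simp only [Set.mem_union, Set.mem_Iio, Set.mem_singleton_iff]; omega

/-! ### The case `m = 2^μ + 1` -/

namespace CasePlus

open PowerSeries

theorem isSymmetric (μ : ℕ) : (polyPlus μ).IsSymmetric := by
  apply isSymmetric_of_rename_swap
  simp [polyPlus]
  ring

theorem evalPoly_eq (μ : ℕ) (σ : Nottingham (ZMod 2)) : Nottingham.evalPoly (polyPlus μ) σ =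
    (X * σ.toPowerSeries) ^ 2 ^ μ + σ.toPowerSeries ^ (2 ^ μ - 1) + X ^ (2 ^ μ - 1) := by
  simp [Nottingham.evalPoly, polyPlus]

theorem two_le_two_pow {μ : ℕ} (hμ : 1 ≤ μ) : 2 ≤ 2 ^ μ := by
  simpa using Nat.pow_le_pow_right (n := 2) (by norm_num) hμ

theorem even_two_pow {μ : ℕ} (hμ : 1 ≤ μ) : Even (2 ^ μ) :=
  (Nat.even_pow.2 ⟨even_two, by omega⟩)

theorem odd_two_pow_sub_one {μ : ℕ} (hμ : 1 ≤ μ) : Odd (2 ^ μ - 1) :=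
  Nat.Even.sub_odd Nat.one_le_two_pow (even_two_pow hμ) odd_one

theorem odd_exponent {μ m : ℕ} (hμ : 1 ≤ μ) (hm : m = 2 ^ μ + 1) : Odd m :=
  hm ▸ (even_two_pow hμ).add_one

/-- Write `σ = X v`, `τ = X w`, `q = 2^μ`. The difference of the equations is `X^(q-1) (v - w) (G +
X^(q+1) (v - w)^(q-1))`, and `G` has constant term 1 since `q - 1` is odd. -/
theorem eq_of_evalPoly {μ : ℕ} (hμ : 1 ≤ μ) {σ τ : Nottingham (ZMod 2)}
    (hσ : Nottingham.evalPoly (polyPlus μ) σ = 0)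
    (hτ : Nottingham.evalPoly (polyPlus μ) τ = 0) : σ = τ := by
  rw [evalPoly_eq] at hσ hτ
  obtain ⟨v, hv, hσv⟩ := σ.exists_eq_X_mul
  obtain ⟨w, hw, hτw⟩ := τ.exists_eq_X_mul
  have hG := Nottingham.constantCoeff_geomSum₂ (odd_two_pow_sub_one hμ) hv hw
  have hg := (Commute.all v w).geom_sum₂_mul (2 ^ μ - 1)
  set G := ∑ i ∈ Finset.range (2 ^ μ - 1), v ^ i * w ^ (2 ^ μ - 1 - 1 - i)
  have h1 := sub_pow_char_pow v w (p := 2) (n := μ)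
  have h2 := mul_pow_sub_one (by positivity : 2 ^ μ ≠ 0) (v - w)
  have h3 := mul_pow_sub_one (by positivity : 2 ^ μ ≠ 0) (X : PowerSeries (ZMod 2))
  have h4 : X ^ (2 ^ μ - 1) * ((v - w) *
      (G + X * (X ^ 2 ^ μ * (v - w) ^ (2 ^ μ - 1)))) = 0 := by
    rw [hσv, mul_pow, mul_pow, mul_pow] at hσ
    rw [hτw, mul_pow, mul_pow, mul_pow] at hτ
    linear_combination hσ - hτ + X ^ (2 ^ μ - 1) * hg + X ^ 2 ^ μ * (v - w) ^ 2 ^ μ * h3 +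
      X ^ 2 ^ μ * X ^ 2 ^ μ * h1 + X ^ (2 ^ μ - 1) * X * X ^ 2 ^ μ * h2
  have h5 := (mul_eq_zero.1 h4).resolve_left (pow_ne_zero _ X_ne_zero)
  have h6 := (mul_eq_zero.1 h5).resolve_right
    (Nottingham.ne_zero_of_constantCoeff (by rw [map_add, hG]; simp))
  apply Nottingham.ext
  rw [hσv, hτw, sub_eq_zero.1 h6]

/-- The exponents `m * 2 ^ (μ k)`. -/
def expo (μ m k : ℕ) : ℕ := m * (2 ^ μ) ^ k

theorem expo_strictMono {μ m : ℕ} (hμ : 1 ≤ μ) (hm : m ≠ 0) : StrictMono (expo μ m) := by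
  refine strictMono_nat_of_lt_succ fun k => ?_
  exact Nat.mul_lt_mul_of_pos_left
    (Nat.pow_lt_pow_right (by have := two_le_two_pow hμ; omega) (Nat.lt_succ_self k))
    (Nat.pos_of_ne_zero hm)

/-- The series `∑ t ^ (m * 2 ^ (μ k))`. -/
noncomputable def base (μ m : ℕ) : PowerSeries (ZMod 2) := indicatorSeries (Set.range (expo μ m))

theorem base_eq {μ m : ℕ} (hμ : 1 ≤ μ) (hm : m ≠ 0) :
    base μ m = X ^ m + base μ m ^ 2 ^ μ := by
  have hmono := expo_strictMono hμ hm
  have hs : ∀ k, 2 ^ μ * expo μ m k = expo μ m (k + 1) := fun k => by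
    simp only [expo, pow_succ]; ring
  have h0 : expo μ m 0 = m := by simp [expo]
  have hd : Disjoint {m} (Set.range fun k => 2 ^ μ * expo μ m k) := by
    rw [Set.disjoint_singleton_left]
    rintro ⟨k, hk⟩
    simp only [hs] at hk
    have := hmono (Nat.succ_pos k)
    rw [h0, Nat.succ_eq_add_one, hk] at this
    exact lt_irrefl _ this
  have hu : {m} ∪ (Set.range fun k => 2 ^ μ * expo μ m k) = Set.range (expo μ m) := by
    simp only [hs]
    ext n
    constructor
    · rintro (rfl | ⟨k, rfl⟩)
      · exact ⟨0, h0⟩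
      · exact ⟨k + 1, rfl⟩
    · rintro ⟨_ | k, rfl⟩
      · exact Or.inl h0
      · exact Or.inr ⟨k, rfl⟩
  rw [base, indicatorSeries_range_pow_two_pow hmono.injective, ← indicatorSeries_singleton,
    ← indicatorSeries_union hd, hu]

theorem exists_base_eq_X_pow_mul {μ m : ℕ} (hμ : 1 ≤ μ) (hm : m ≠ 0) :
    ∃ c : PowerSeries (ZMod 2), constantCoeff c = 1 ∧ base μ m = X ^ m * c := by
  have h0 : expo μ m 0 = m := by simp [expo]
  have hdvd : X ^ m ∣ base μ m := by
    rw [X_pow_dvd_iff]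
    intro n hn
    rw [base, coeff_indicatorSeries, if_neg]
    rintro ⟨k, rfl⟩
    have := (expo_strictMono hμ hm).monotone (Nat.zero_le k)
    omega
  obtain ⟨c, hc⟩ := hdvd
  refine ⟨c, ?_, hc⟩
  have h1 : coeff m (base μ m) = 1 := by
    rw [base, coeff_indicatorSeries, if_pos ⟨0, h0⟩]
  simpa [hc, coeff_X_pow_mul'] using h1

theorem constantCoeff_one_add_base {μ m : ℕ} (hμ : 1 ≤ μ) (hm : m ≠ 0) :
    constantCoeff (1 + base μ m) = 1 := by
  obtain ⟨c, -, h⟩ := exists_base_eq_X_pow_mul hμ hm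
  rw [h]; simp [hm]

theorem one_add_base_mul_inv {μ m : ℕ} (hμ : 1 ≤ μ) (hm : m ≠ 0) :
    (1 + base μ m) * (1 + base μ m)⁻¹ = 1 :=
  PowerSeries.mul_inv_cancel _ (by rw [constantCoeff_one_add_base hμ hm]; exact one_ne_zero)

theorem constantCoeff_inv {μ m : ℕ} (hμ : 1 ≤ μ) (hm : m ≠ 0) :
    constantCoeff (1 + base μ m)⁻¹ = 1 := by
  rw [PowerSeries.constantCoeff_inv, constantCoeff_one_add_base hμ hm, inv_one]

/-- The series `t / (1 + ∑ t ^ (m * 2 ^ (μ k)))`. -/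
noncomputable def sigma {μ m : ℕ} (hμ : 1 ≤ μ) (hm : m ≠ 0) : Nottingham (ZMod 2) :=
  Nottingham.ofXMul (1 + base μ m)⁻¹ (constantCoeff_inv hμ hm)

theorem hasLeadingForm_sigma {μ m : ℕ} (hμ : 1 ≤ μ) (hm : m ≠ 0) :
    (sigma hμ hm).HasLeadingForm m := by
  obtain ⟨c, hc, h⟩ := exists_base_eq_X_pow_mul hμ hm
  refine Nottingham.hasLeadingForm_iff_exists.2 ⟨c * (1 + base μ m)⁻¹,
    by rw [map_mul, hc, constantCoeff_inv hμ hm, one_mul], ?_⟩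
  change X * (1 + base μ m)⁻¹ = _
  linear_combination X * one_add_base_mul_inv hμ hm - X * (1 + base μ m)⁻¹ * h -
    X * X ^ m * c * (1 + base μ m)⁻¹ * two_eq_zero_series

theorem one_add_base_pow {μ m : ℕ} (hμ : 1 ≤ μ) (hm : m ≠ 0) :
    (1 + base μ m) ^ 2 ^ μ = 1 + base μ m + X ^ m := by
  rw [add_pow_char_pow (p := 2), one_pow]
  linear_combination -base_eq hμ hm - X ^ m * two_eq_zero_series

theorem evalPoly_sigma {μ m : ℕ} (hμ : 1 ≤ μ) (hm : m ≠ 0) (hmμ : m = 2 ^ μ + 1) :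
    Nottingham.evalPoly (polyPlus μ) (sigma hμ hm) = 0 := by
  have h1 := one_add_base_mul_inv hμ hm
  have h2 := one_add_base_pow hμ hm
  have hB := Nottingham.ne_zero_of_constantCoeff (constantCoeff_one_add_base hμ hm)
  rw [evalPoly_eq]
  change (X * (X * (1 + base μ m)⁻¹)) ^ 2 ^ μ + (X * (1 + base μ m)⁻¹) ^ (2 ^ μ - 1) +
    X ^ (2 ^ μ - 1) = 0
  set B := 1 + base μ m
  set b := B⁻¹
  have h3 : B ^ 2 ^ μ * b ^ 2 ^ μ = 1 := by rw [← mul_pow, h1, one_pow]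
  have h4 : B ^ 2 ^ μ * b ^ (2 ^ μ - 1) = B := by
    rw [← mul_pow_sub_one (by positivity : 2 ^ μ ≠ 0) B, mul_assoc, ← mul_pow, h1, one_pow, mul_one]
  have h5 := mul_pow_sub_one (by positivity : 2 ^ μ ≠ 0) (X : PowerSeries (ZMod 2))
  rw [hmμ, pow_succ] at h2
  -- Clearing denominators with `q = 2^μ` leaves `X^(2q) + X^(q-1) (B + B^q)`, which vanishes
  -- because `B^q = B + X^(q+1)`.
  refine (mul_eq_zero.1 (?_ : B ^ 2 ^ μ * _ = 0)).resolve_left (pow_ne_zero _ hB)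
  rw [mul_pow, mul_pow, mul_pow]
  linear_combination X ^ 2 ^ μ * X ^ 2 ^ μ * h3 + X ^ (2 ^ μ - 1) * h4 + X ^ (2 ^ μ - 1) * h2 +
    X ^ 2 ^ μ * h5 + (X ^ (2 ^ μ - 1) * B + X ^ 2 ^ μ * X ^ 2 ^ μ) * two_eq_zero_series

theorem isUniqueSymmetricSolution {μ m : ℕ} (hμ : 1 ≤ μ) (hm : m ≠ 0) (hmμ : m = 2 ^ μ + 1) :
    (sigma hμ hm).IsUniqueSymmetricSolution (polyPlus μ) m :=
  ⟨isSymmetric μ, ⟨hasLeadingForm_sigma hμ hm, evalPoly_sigma hμ hm hmμ⟩,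
    fun _ _ h => eq_of_evalPoly hμ h (evalPoly_sigma hμ hm hmμ)⟩

theorem indicatorSeries_residueSet_singleton {μ m j : ℕ} (hμ : 1 ≤ μ) (hm : m ≠ 0) (hj : j < μ) :
    indicatorSeries (residueSet μ m {j}) = (1 + base μ m) ^ 2 ^ j := by
  rw [residueSet_singleton m hj, indicatorSeries_union, indicatorSeries_singleton, pow_zero,
    add_pow_char_pow (p := 2), one_pow, base,
    indicatorSeries_range_pow_two_pow (expo_strictMono hμ hm).injective]
  · rfl
  · rw [Set.disjoint_singleton_left]
    rintro ⟨k, hk⟩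
    simp [hm] at hk

/-- Since `2^μ - 1 = ∑_{j<μ} 2^j`, the power is a product of Frobenius twists, and the `j`-th one
contributes at most one digit, at a position congruent to `j`. -/
theorem one_add_base_pow_sub_one {μ m : ℕ} (hμ : 1 ≤ μ) (hm : m ≠ 0) :
    (1 + base μ m) ^ (2 ^ μ - 1) = indicatorSeries (residueSet μ m Set.univ) := by
  have h1 : residueSet μ m Set.univ = residueSet μ m (Set.Iio μ) := by
    have : ∀ i, i % μ < μ := fun i => Nat.mod_lt i hμ
    simp [residueSet, this]
  have h2 : ∑ j ∈ Finset.range μ, 2 ^ j = 2 ^ μ - 1 := by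
    simpa using Nat.geomSum_eq le_rfl μ
  rw [h1, ← prod_indicatorSeries_residueSet hm, ← h2, ← Finset.prod_pow_eq_pow_sum]
  exact Finset.prod_congr rfl fun j hj =>
    (indicatorSeries_residueSet_singleton hμ hm (Finset.mem_range.1 hj)).symm

/-- The support of `sigma`. -/
def support (μ m : ℕ) : Set ℕ :=
  {n | ∃ s : Finset ℕ, s.Nonempty ∧ Set.InjOn (fun i => i % μ) (s : Set ℕ) ∧
    m * ofPositions s - m + 1 = n}

theorem ofPositions_pos {s : Finset ℕ} (hs : s.Nonempty) : 1 ≤ ofPositions s := by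
  obtain ⟨i, hi⟩ := hs
  exact Nat.one_le_two_pow.trans
    (Finset.single_le_sum (f := fun i => 2 ^ i) (fun _ _ => Nat.zero_le _) hi)

theorem sigma_eq_indicatorSeries {μ m : ℕ} (hμ : 1 ≤ μ) (hm : m ≠ 0) (hmμ : m = 2 ^ μ + 1) :
    (sigma hμ hm).toPowerSeries = indicatorSeries (support μ m) := by
  have h1 := one_add_base_mul_inv hμ hm
  have h2 := one_add_base_pow hμ hm
  have hB := Nottingham.ne_zero_of_constantCoeff (constantCoeff_one_add_base hμ hm)
  -- Divide `X^m = (1 + base)^(2^μ) + (1 + base)` by `1 + base`. The added 1 removes the empty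
  -- position set, and the shift by `2^μ = m - 1` produces the exponents `m l - m + 1`.
  have h3 : X ^ 2 ^ μ * (sigma hμ hm).toPowerSeries = (1 + base μ m) ^ (2 ^ μ - 1) + 1 := by
    refine mul_left_cancel₀ hB ?_
    have h4 := mul_pow_sub_one (by positivity : 2 ^ μ ≠ 0) (1 + base μ m)
    change (1 + base μ m) * (X ^ 2 ^ μ * (X * (1 + base μ m)⁻¹)) = _
    rw [hmμ, pow_succ, ← hmμ] at h2
    linear_combination X ^ 2 ^ μ * X * h1 - h4 - h2 - (1 + base μ m) * two_eq_zero_series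
  rw [one_add_base_pow_sub_one hμ hm] at h3
  ext n
  have h4 := congrArg (coeff (n + 2 ^ μ)) h3
  rw [coeff_X_pow_mul, map_add, coeff_one, if_neg (by positivity), add_zero] at h4
  rw [h4, coeff_indicatorSeries, coeff_indicatorSeries]
  congr 1
  apply propext
  constructor
  · rintro ⟨s, hs, -, h⟩
    have hne : s.Nonempty := by
      rw [Finset.nonempty_iff_ne_empty]
      rintro rfl
      have := Nat.one_le_two_pow (n := μ)
      simp only [ofPositions, Finset.sum_empty, mul_zero] at h
      omega
    refine ⟨s, hne, hs, ?_⟩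
    have := Nat.mul_le_mul_left m (ofPositions_pos hne)
    omega
  · rintro ⟨s, hne, hs, h⟩
    refine ⟨s, hs, by simp, ?_⟩
    have := Nat.mul_le_mul_left m (ofPositions_pos hne)
    omega

theorem card_le_of_injOn_mod {μ : ℕ} (hμ : 1 ≤ μ) {s : Finset ℕ}
    (hs : Set.InjOn (fun i => i % μ) (s : Set ℕ)) : s.card ≤ μ := by
  rw [← Finset.card_image_of_injOn hs]
  calc _ ≤ (Finset.range μ).card := Finset.card_le_card fun j hj => by
        obtain ⟨i, -, rfl⟩ := Finset.mem_image.1 hj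
        exact Finset.mem_range.2 (Nat.mod_lt i hμ)
    _ = μ := Finset.card_range μ

/-- The bound on the number of digits 1 is automatic: positions distinct modulo `μ` number at most
`μ`. -/
theorem support_eq {μ m : ℕ} (hμ : 1 ≤ μ) : support μ m = {n : ℕ | ∃ l : ℕ, 1 ≤ l ∧
    n = m * (l - 1) + 1 ∧ (onePositions l).ncard ≤ μ ∧
      Set.InjOn (fun i => i % μ) (onePositions l)} := by
  ext n
  constructor
  · rintro ⟨s, hne, hs, rfl⟩
    refine ⟨ofPositions s, ofPositions_pos hne, by rw [Nat.mul_sub, mul_one], ?_, ?_⟩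
    · rw [onePositions_ofPositions, Set.ncard_coe_finset]
      exact card_le_of_injOn_mod hμ hs
    · rwa [onePositions_ofPositions]
  · rintro ⟨l, hl, rfl, -, hinj⟩
    obtain ⟨s, rfl⟩ := ofPositions_surjective l
    rw [onePositions_ofPositions] at hinj
    refine ⟨s, ?_, hinj, by rw [Nat.mul_sub, mul_one]⟩
    rw [Finset.nonempty_iff_ne_empty]
    rintro rfl
    simp [ofPositions] at hl

/-- The positions of the digits `1` described by `p`. -/
def positions {μ : ℕ} (p : PlusIndex μ) : Finset ℕ :=
  Finset.univ.image fun j : {j // j ∈ p.1.1} => (j.1 : ℕ) + μ * p.2 j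

theorem mem_positions {μ : ℕ} (p : PlusIndex μ) (i : ℕ) :
    i ∈ positions p ↔ ∃ j : {j // j ∈ p.1.1}, (j.1 : ℕ) + μ * p.2 j = i := by
  simp [positions]

theorem add_mul_mod {μ : ℕ} (j : Fin μ) (k : ℕ) : ((j : ℕ) + μ * k) % μ = j := by
  rw [Nat.add_mul_mod_self_left, Nat.mod_eq_of_lt j.2]

theorem add_mul_div {μ : ℕ} (j : Fin μ) (k : ℕ) : ((j : ℕ) + μ * k) / μ = k := by
  rw [Nat.add_mul_div_left _ _ (Nat.lt_of_le_of_lt (Nat.zero_le _) j.2),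
    Nat.div_eq_of_lt j.2, zero_add]

theorem positions_nonempty {μ : ℕ} (p : PlusIndex μ) : (positions p).Nonempty := by
  obtain ⟨j, hj⟩ := p.1.2
  exact ⟨_, (mem_positions p _).2 ⟨⟨j, hj⟩, rfl⟩⟩

theorem positions_injOn {μ : ℕ} (p : PlusIndex μ) :
    Set.InjOn (fun i => i % μ) (positions p : Set ℕ) := by
  intro i hi i' hi' h
  obtain ⟨j, rfl⟩ := (mem_positions p i).1 hi
  obtain ⟨j', rfl⟩ := (mem_positions p i').1 hi'
  simp only [add_mul_mod] at h
  rw [Subtype.ext (Fin.ext h)]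

/-- Remainder and quotient of a position by `μ` recover `j` and `k(j)`. -/
theorem positions_injective {μ : ℕ} : Function.Injective (positions (μ := μ)) := by
  have key : ∀ p p' : PlusIndex μ, positions p = positions p' → ∀ j (hj : j ∈ p.1.1),
      ∃ hj' : j ∈ p'.1.1, p.2 ⟨j, hj⟩ = p'.2 ⟨j, hj'⟩ := by
    intro p p' h j hj
    obtain ⟨⟨j', hj'⟩, h'⟩ := (mem_positions p' _).1
      (h ▸ (mem_positions p _).2 ⟨⟨j, hj⟩, rfl⟩)
    have h1 := congrArg (· % μ) h'
    have h2 := congrArg (· / μ) h'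
    simp only [add_mul_mod, add_mul_div] at h1 h2
    obtain rfl := Fin.ext h1
    exact ⟨hj', h2.symm⟩
  rintro ⟨⟨J, hJ⟩, k⟩ ⟨⟨J', hJ'⟩, k'⟩ h
  obtain rfl : J = J' := Finset.ext fun j => ⟨fun hj => (key _ _ h j hj).1,
    fun hj => (key _ _ h.symm j hj).1⟩
  obtain rfl : k = k' := funext fun j => (key _ _ h j.1 j.2).2
  rfl

theorem exists_positions_eq {μ : ℕ} (hμ : 1 ≤ μ) {s : Finset ℕ} (hne : s.Nonempty)
    (hs : Set.InjOn (fun i => i % μ) (s : Set ℕ)) : ∃ p : PlusIndex μ, positions p = s := by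
  classical
  let J : Finset (Fin μ) := Finset.univ.filter fun j => ∃ i ∈ s, i % μ = j
  have hJ : ∀ j : {j // j ∈ J}, ∃ i ∈ s, i % μ = j.1 := fun j => (Finset.mem_filter.1 j.2).2
  choose f hf hf' using hJ
  obtain ⟨i₀, hi₀⟩ := hne
  have hmem : ∀ i ∈ s, (⟨i % μ, Nat.mod_lt i hμ⟩ : Fin μ) ∈ J := fun i hi =>
    Finset.mem_filter.2 ⟨Finset.mem_univ _, i, hi, rfl⟩
  have hfeq : ∀ j, (j.1 : ℕ) + μ * (f j / μ) = f j := fun j => by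
    rw [← hf' j, Nat.mod_add_div]
  refine ⟨⟨⟨J, ⟨_, hmem i₀ hi₀⟩⟩, fun j => f j / μ⟩, ?_⟩
  ext i
  rw [mem_positions]
  constructor
  · rintro ⟨j, rfl⟩
    exact (hfeq j).symm ▸ hf j
  · intro hi
    refine ⟨⟨_, hmem i hi⟩, (hfeq _).trans ?_⟩
    exact hs (hf _) hi (hf' _)

theorem plusExponent_eq {μ m : ℕ} (hmμ : m = 2 ^ μ + 1) (p : PlusIndex μ) :
    plusExponent m p = m * ofPositions (positions p) - m + 1 := by
  have h : ofPositions (positions p) =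
      ∑ j : {j // j ∈ p.1.1}, 2 ^ (j.1 : ℕ) * (m - 1) ^ p.2 j := by
    rw [ofPositions, positions, Finset.sum_image]
    · refine Finset.sum_congr rfl fun j _ => ?_
      rw [pow_add, pow_mul, hmμ, Nat.add_sub_cancel]
    · intro j _ j' _ h
      have h1 := congrArg (· % μ) h
      simp only [add_mul_mod] at h1
      exact Subtype.ext (Fin.ext h1)
  rw [plusExponent, ← h, mul_comm]

theorem plusExponent_injective {μ m : ℕ} (hmμ : m = 2 ^ μ + 1) :
    Function.Injective (plusExponent (μ := μ) m) := by
  intro p p' h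
  have hm : 0 < m := hmμ ▸ Nat.succ_pos _
  rw [plusExponent_eq hmμ, plusExponent_eq hmμ] at h
  have h1 := Nat.mul_le_mul_left m (ofPositions_pos (positions_nonempty p))
  have h2 := Nat.mul_le_mul_left m (ofPositions_pos (positions_nonempty p'))
  exact positions_injective (ofPositions_injective
    (Nat.eq_of_mul_eq_mul_left hm (by omega)))

theorem range_plusExponent {μ m : ℕ} (hμ : 1 ≤ μ) (hmμ : m = 2 ^ μ + 1) :
    Set.range (plusExponent (μ := μ) m) = support μ m := by
  ext n
  constructor
  · rintro ⟨p, rfl⟩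
    exact ⟨positions p, positions_nonempty p, positions_injOn p, (plusExponent_eq hmμ p).symm⟩
  · rintro ⟨s, hne, hs, rfl⟩
    obtain ⟨p, rfl⟩ := exists_positions_eq hμ hne hs
    exact ⟨p, plusExponent_eq hmμ p⟩

theorem hasSum_sigma {μ m : ℕ} (hμ : 1 ≤ μ) (hm : m ≠ 0) (hmμ : m = 2 ^ μ + 1) :
    HasSum (fun p : PlusIndex μ => (X ^ plusExponent m p : PowerSeries (ZMod 2)))
      (sigma hμ hm).toPowerSeries := by
  rw [sigma_eq_indicatorSeries hμ hm hmμ, ← range_plusExponent hμ hmμ]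
  exact hasSum_indicatorSeries (plusExponent_injective hmμ)

theorem ncard_support_le {μ m : ℕ} (hμ : 1 ≤ μ) (hm : m ≠ 0) {N K : ℕ} (hNK : N < 2 ^ K) :
    (support μ m ∩ Set.Iic N).ncard ≤ (1 * (K + 1)) ^ μ := by
  classical
  have h := ncard_le_card_of_forall_exists (S := support μ m ∩ Set.Iic N)
    -- A position set is encoded by sending each residue to its position plus 1, or to 0 if the
    -- residue does not occur.
    (Fintype.piFinset fun _ : Fin μ => Finset.range (K + 1))
    (fun h => m * ofPositions ((Finset.range K).filter fun i =>
      h ⟨i % μ, Nat.mod_lt i hμ⟩ = i + 1) - m + 1) ?_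
  · simpa using h
  · rintro n ⟨⟨s, hne, hs, rfl⟩, hn⟩
    have hlt : ofPositions s < 2 ^ K := by
      have h1 := ofPositions_pos hne
      have h2 : m * ofPositions s - m = m * (ofPositions s - 1) := by rw [Nat.mul_sub, mul_one]
      have h3 : ofPositions s - 1 ≤ m * (ofPositions s - 1) :=
        Nat.le_mul_of_pos_left _ (Nat.pos_of_ne_zero hm)
      have h4 : m * (ofPositions s - 1) + 1 ≤ N := h2 ▸ hn
      omega
    have hsK : ∀ i ∈ s, i < K := fun i hi => (Nat.pow_lt_pow_iff_right (a := 2) (by norm_num)).1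
      (lt_of_le_of_lt
        (Finset.single_le_sum (f := fun i => 2 ^ i) (fun _ _ => Nat.zero_le _) hi) hlt)
    let h : Fin μ → ℕ := fun j => if H : ∃ i ∈ s, i % μ = j then H.choose + 1 else 0
    have hh : ∀ i, h ⟨i % μ, Nat.mod_lt i hμ⟩ = i + 1 ↔ i ∈ s := by
      intro i
      simp only [h]
      split_ifs with H
      · obtain ⟨h1, h2⟩ := H.choose_spec
        constructor
        · intro h3
          rwa [← Nat.add_right_cancel h3]
        · intro hi
          rw [hs h1 hi h2]
      · exact iff_of_false not_false fun hi => H ⟨i, hi, rfl⟩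
    refine ⟨h, ?_, ?_⟩
    · rw [Fintype.mem_piFinset]
      intro j
      simp only [h]
      split_ifs with H
      · have := hsK _ H.choose_spec.1
        rw [Finset.mem_range]; omega
      · simp
    · have : ((Finset.range K).filter fun i => h ⟨i % μ, Nat.mod_lt i hμ⟩ = i + 1) = s := by
        ext i
        rw [Finset.mem_filter, hh, Finset.mem_range]
        exact ⟨fun h => h.2, fun h => ⟨hsK i h, h⟩⟩
      rw [this]

theorem le_ncard_support {μ m : ℕ} (hμ : 1 ≤ μ) (hmμ : m = 2 ^ μ + 1) (K : ℕ) :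
    K ^ μ ≤ (support μ m ∩ Set.Iic (m * (2 ^ μ) ^ K)).ncard := by
  classical
  -- The lower bound uses only full sets `J`: each of the `μ` values `k(j) < K` is free, and all
  -- positions stay below `μ K`.
  let index : (Fin μ → ℕ) → PlusIndex μ := fun k =>
    ⟨⟨Finset.univ, ⟨⟨0, hμ⟩, Finset.mem_univ _⟩⟩, fun j => k j.1⟩
  have hindex : Function.Injective index := by
    intro k k' h
    have := eq_of_heq (Sigma.mk.inj h).2
    funext j
    exact congrFun this ⟨j, Finset.mem_univ _⟩
  have h := card_le_ncard_of_injective (S := support μ m ∩ Set.Iic (m * (2 ^ μ) ^ K))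
    ((Set.finite_Iic _).inter_of_right _) (Fintype.piFinset fun _ : Fin μ => Finset.range K)
    ((plusExponent_injective hmμ).comp hindex) ?_
  · simpa using h
  · intro k hk
    refine ⟨range_plusExponent hμ hmμ ▸ ⟨_, rfl⟩, ?_⟩
    have hlt : ofPositions (positions (index k)) < 2 ^ (μ * K) := by
      refine Nat.geomSum_lt le_rfl fun i hi => ?_
      obtain ⟨j, rfl⟩ := (mem_positions _ i).1 hi
      have h1 : k j.1 + 1 ≤ K := Finset.mem_range.1 (Fintype.mem_piFinset.1 hk j.1)
      have h2 := Nat.mul_le_mul_left μ h1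
      have h3 := j.1.2
      change (j.1 : ℕ) + μ * k j.1 < μ * K
      rw [mul_add, mul_one] at h2
      omega
    have h1 := ofPositions_pos (positions_nonempty (index k))
    have h2 := Nat.mul_le_mul_left m h1
    have h3 := Nat.mul_le_mul_left m hlt.le
    have h4 : 0 < m := hmμ ▸ Nat.succ_pos _
    simp only [Function.comp_apply, Set.mem_Iic]
    rw [plusExponent_eq hmμ, ← pow_mul]
    omega

theorem isSparse_and_rank {μ m : ℕ} (hμ : 1 ≤ μ) (hm : m ≠ 0) (hmμ : m = 2 ^ μ + 1) :
    IsSparse (sigma hμ hm).toPowerSeries ∧ sparsenessRank (sigma hμ hm).toPowerSeries = μ := by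
  refine isSparse_and_sparsenessRank_eq (C := 1) (b := 2 ^ μ) (c := m) (fun N K hNK => ?_)
    (two_le_two_pow hμ) (Nat.pos_of_ne_zero hm) fun K => ?_
  · rw [sigma_eq_indicatorSeries hμ hm hmμ, seriesSupport_indicatorSeries]
    exact ncard_support_le hμ hm hNK
  · rw [sigma_eq_indicatorSeries hμ hm hmμ, seriesSupport_indicatorSeries]
    exact le_ncard_support hμ hmμ K

end CasePlus

/-! ### Assembly of the cases -/

theorem mainTheorem4 :
    -- every element of order two and break sequence `(2^μ ± 1)` is conjugate to a sparse series
    (∀ μ m : ℕ, 1 ≤ μ → (m = 2 ^ μ - 1 ∨ m = 2 ^ μ + 1) →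
      ∀ ρ : Nottingham (ZMod 2), orderOf ρ = 2 → ρ.breakSequence = [(m : ℕ∞)] →
        ∃ τ : Nottingham (ZMod 2), IsSparse τ.toPowerSeries ∧ IsConj ρ τ) ∧
    -- the case `m = 1`
    (∃ σ : Nottingham (ZMod 2),
      HasSum
        (fun k : {k : ℕ // 2 ≤ k} =>
          (PowerSeries.X ^ (2 ^ k.1 - 2) + PowerSeries.X ^ (2 ^ k.1 - 1) : PowerSeries (ZMod 2)))
        (σ.toPowerSeries - PowerSeries.X) ∧
      σ.RepresentsInvolutions 1 ∧
      σ.IsUniqueSymmetricSolution polyOne 1 ∧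
      IsSparse σ.toPowerSeries ∧ sparsenessRank σ.toPowerSeries = 1 ∧
      automatonOne.series = σ.toPowerSeries) ∧
    -- the case `m = 2^μ - 1 > 1`
    (∀ (μ m : ℕ) (hμ : 2 ≤ μ), m = 2 ^ μ - 1 →
      ∃ σ : Nottingham (ZMod 2),
        HasSum
          (fun k : {k : ℕ // 1 ≤ k} =>
            (PowerSeries.X ^ minusExponent m k.1 : PowerSeries (ZMod 2)))
          (σ.toPowerSeries - PowerSeries.X) ∧
        σ.RepresentsInvolutions m ∧
        σ.IsUniqueSymmetricSolution (polyMinus μ) m ∧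
        IsSparse σ.toPowerSeries ∧ sparsenessRank σ.toPowerSeries = 1 ∧
        seriesSupport σ.toPowerSeries =
          {n : ℕ | binaryWord n = [true] ∨ ∃ l : ℕ, binaryWord n = supportWord μ l} ∧
        (automatonMinus μ hμ).series = σ.toPowerSeries) ∧
    -- the case `m = 2^μ + 1`
    (∀ μ m : ℕ, 1 ≤ μ → m = 2 ^ μ + 1 →
      ∃ σ : Nottingham (ZMod 2),
        HasSum
          (fun p : PlusIndex μ => (PowerSeries.X ^ plusExponent m p : PowerSeries (ZMod 2)))
          σ.toPowerSeries ∧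
        σ.RepresentsInvolutions m ∧
        σ.IsUniqueSymmetricSolution (polyPlus μ) m ∧
        IsSparse σ.toPowerSeries ∧ sparsenessRank σ.toPowerSeries = μ ∧
        seriesSupport σ.toPowerSeries =
          {n : ℕ | ∃ l : ℕ, 1 ≤ l ∧ n = m * (l - 1) + 1 ∧
            (onePositions l).ncard ≤ μ ∧ Set.InjOn (fun i => i % μ) (onePositions l)}) := by
  have hone := Nottingham.IsUniqueSymmetricSolution.representsInvolutions odd_one
    CaseOne.isUniqueSymmetricSolution
  have hminus : ∀ (μ m : ℕ) (hμ : 2 ≤ μ), m = 2 ^ μ - 1 →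
      (CaseMinus.sigma hμ).RepresentsInvolutions m := fun μ m hμ hm =>
    (CaseMinus.isUniqueSymmetricSolution hμ hm).representsInvolutions
      (CaseMinus.odd_exponent hμ hm)
  have hplus : ∀ (μ m : ℕ) (hμ : 1 ≤ μ) (hm : m ≠ 0), m = 2 ^ μ + 1 →
      (CasePlus.sigma hμ hm).RepresentsInvolutions m := fun μ m hμ hm hmμ =>
    (CasePlus.isUniqueSymmetricSolution hμ hm hmμ).representsInvolutions
      (CasePlus.odd_exponent hμ hmμ)
  refine ⟨?_, ?_, ?_, ?_⟩
  · rintro μ m hμ (hm | hm) ρ hρ hb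
    -- For `μ = 1` the exponent `2^μ - 1` is 1, which has its own series.
    · obtain rfl | hμ' := hμ.eq_or_lt
      · obtain rfl : m = 1 := hm
        exact ⟨_, CaseOne.isSparse_and_rank.1, hone.2 ρ hρ hb⟩
      · exact ⟨_, (CaseMinus.isSparse_and_rank hμ').1, (hminus μ m hμ' hm).2 ρ hρ hb⟩
    · have hm0 : m ≠ 0 := hm ▸ Nat.succ_ne_zero _
      exact ⟨_, (CasePlus.isSparse_and_rank hμ hm0 hm).1, (hplus μ m hμ hm0 hm).2 ρ hρ hb⟩
  · exact ⟨CaseOne.sigma, CaseOne.hasSum_sigma, hone, CaseOne.isUniqueSymmetricSolution,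
      CaseOne.isSparse_and_rank.1, CaseOne.isSparse_and_rank.2, CaseOne.automatonOne_series⟩
  · intro μ m hμ hm
    exact ⟨CaseMinus.sigma hμ, CaseMinus.hasSum_sigma hμ hm, hminus μ m hμ hm,
      CaseMinus.isUniqueSymmetricSolution hμ hm, (CaseMinus.isSparse_and_rank hμ).1,
      (CaseMinus.isSparse_and_rank hμ).2, CaseMinus.seriesSupport_sigma hμ,
      CaseMinus.automatonMinus_series hμ⟩
  · intro μ m hμ hm
    have hm0 : m ≠ 0 := hm ▸ Nat.succ_ne_zero _
    refine ⟨CasePlus.sigma hμ hm0, CasePlus.hasSum_sigma hμ hm0 hm, hplus μ m hμ hm0 hm,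
      CasePlus.isUniqueSymmetricSolution hμ hm0 hm, (CasePlus.isSparse_and_rank hμ hm0 hm).1,
      (CasePlus.isSparse_and_rank hμ hm0 hm).2, ?_⟩
    rw [CasePlus.sigma_eq_indicatorSeries hμ hm0 hm, seriesSupport_indicatorSeries,
      CasePlus.support_eq hμ]
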